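/- Let $n,m\ge 0$ be integers with $d=n+m\ge 1$, and let $\mathbb R^d=\mathbb R^n\times\mathbb R^m$, $z=(x,y)$, carry the Euclidean norm (so $B=\mathbf I$). Let $f:\mathbb R^d\to\mathbb R$ be Lipschitz with constant $L_0>0$, let $\mu>0$, and let $f_\mu(z)=E_{u\sim\mathcal N(0,\mathbf I)}[f(z+\mu u)]$. Then $f_\mu$ is differentiable and its gradient is Lipschitz with constant $\sqrt d\,L_0/\mu$. Put $F_\mu(z)=(\nabla_xf_\mu(z),-\nabla_yf_\mu(z))$ and, for $u=(u_1,u_2)\in\mathbb R^n\times\mathbb R^m$, let $G_\mu(z;u)=\frac{f(z+\mu u)-f(z)}{\mu}(u_1,-u_2)$. Let $L_1>0$ be any Lipschitz constant $L_1(f_\mu)$ of $\nabla f_\mu$ (for instance $\sqrt d\,L_0/\mu$). Let $\sigma\ge0$ satisfy $E_{u\sim\mathcal N(0,\mathbf I)}\|G_\mu(z;u)-F_\mu(z)\|^2\le\sigma^2$ for all $z$, and suppose that there are $\rho\in[0,\frac1{4L_1})$ and $z^\ast\in\mathbb R^d$ with $$\langle F_\mu(z),z-z^\ast\rangle+\tfrac{\rho}{2}\|F_\mu(z)\|^2\ge0\qquad\text{for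 all }z\in\mathbb R^d.$$ Let $h_1\le\frac1{L_1}$ and $h_2\in\big(\sqrt{\rho/L_1},\,h_1/2\big]$. Given $z_0\in\mathbb R^d$ and independent $\mathcal N(0,\mathbf I)$ vectors $\hat u_0,u_0,\hat u_1,u_1,\dots$ in $\mathbb R^d$, the algorithm ZO-EG generates $$\hat z_k=z_k-h_1G_\mu(z_k;\hat u_k),\qquad z_{k+1}=z_k-h_2G_\mu(\hat z_k;u_k),\qquad k=0,1,2,\dots$$ Let $r_0=\|z_0-z^\ast\|$, $0<\delta<1$ and $\epsilon>0$. If $$\mu\le\frac{\delta}{\sqrt{d\pi e}}\Big(\frac{\epsilon}{8L_0}\Big)^{1/d}\qquad\text{and}\qquad N\ge\Big\lceil\frac{8r_0^2L_1}{L_1h_2^2-\rho}\,\epsilon^{-2}-1\Big\rceil,\quad N\in\mathbb N,$$ then there is $k\in\{0,\dots,N\}$ such that the iterate $\hat z_k$ is, in expectation, a $(\delta,\bar\epsilon)$-Goldstein stationary point of $f$, that is, $$E\big[\min\{\|g\|:g\in\partial_\delta f(\hat z_k)\}\big]\le\bar\epsilon,\qquad \bar\epsilon=\epsilon+\sqrt{\frac{3}{L_1(L_1h_2^2-\rho)}}\;\sigma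 .$$ Here $\partial_\delta f(z)=\operatorname{conv}\bigcup_{\|z'-z\|\le\delta}\partial f(z')$ is the Goldstein subdifferential, $\partial f(z)=\{g:\langle g,v\rangle\le f^\circ(z;v)\ \forall v\}$ is Clarke's generalised gradient, and $f^\circ(z;v)=\limsup_{z'\to z,\,t\downarrow0}\frac{f(z'+tv)-f(z')}{t}$. -/

import Mathlib

open MeasureTheory ProbabilityTheory Filter Topology

namespace ZOEG

/-- The space `ℝⁿ × ℝᵐ` with its Euclidean norm (the case `B = I`). The coordinates `Sum.inl i` are
those of the minimisation variable `x`, the coordinates `Sum.inr j` those of the maximisation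
variable `y`. -/
abbrev Z (n m : ℕ) : Type := EuclideanSpace ℝ (Fin n ⊕ Fin m)

/-- `(a, b) ↦ (a, -b)`. -/
noncomputable def flipY {n m : ℕ} (v : Z n m) : Z n m :=
  WithLp.toLp 2 (Sum.elim (fun i => v (Sum.inl i)) (fun j => -v (Sum.inr j)))

/-- Gaussian smoothing `f_μ(z) = E_u [f (z + μ u)]` with `u ∼ N(0, I)`. -/
noncomputable def smooth {n m : ℕ} (f : Z n m → ℝ) (μ : ℝ) (z : Z n m) : ℝ :=
  ∫ u, f (z + μ • u) ∂(stdGaussian (Z n m))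

/-- `F_μ(z) = (∇ₓ f_μ(z), -∇_y f_μ(z))`. -/
noncomputable def smoothOp {n m : ℕ} (f : Z n m → ℝ) (μ : ℝ) (z : Z n m) : Z n m :=
  flipY (gradient (smooth f μ) z)

/-- The random oracle `G_μ(z)` in the direction `u = (u₁, u₂)`: the vector
`((f(z + μ u) - f(z)) / μ) (u₁, -u₂)`. -/
noncomputable def oracle {n m : ℕ} (f : Z n m → ℝ) (μ : ℝ) (u z : Z n m) : Z n m :=
  ((f (z + μ • u) - f z) / μ) • flipY u

/-- The extrapolation step `ẑ = z - h G_μ(z)`, with the oracle in the direction `u`. -/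
noncomputable def extrapolate {n m : ℕ} (f : Z n m → ℝ) (μ h : ℝ) (u z : Z n m) : Z n m :=
  z - h • oracle f μ u z

/-- The iterates `z_k` of the (unconstrained) zeroth-order extragradient algorithm with step sizes
`h₁ k`, `h₂ k`, starting point `z₀` and sampled directions `uhat k`, `u k`:
`ẑ_k = z_k - h₁ k • G_μ(z_k)` with direction `uhat k`, and
`z_{k+1} = z_k - h₂ k • G_μ(ẑ_k)` with direction `u k`. -/
noncomputable def iterate {n m : ℕ} (f : Z n m → ℝ) (μ : ℝ) (h₁ h₂ : ℕ → ℝ) (z₀ : Z n m)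
    (uhat u : ℕ → Z n m) : ℕ → Z n m
  | 0 => z₀
  | k + 1 =>
    iterate f μ h₁ h₂ z₀ uhat u k -
      h₂ k • oracle f μ (u k)
        (extrapolate f μ (h₁ k) (uhat k) (iterate f μ h₁ h₂ z₀ uhat u k))

/-- The iterates `ẑ_k` of the zeroth-order extragradient algorithm. -/
noncomputable def iterateHat {n m : ℕ} (f : Z n m → ℝ) (μ : ℝ) (h₁ h₂ : ℕ → ℝ) (z₀ : Z n m)
    (uhat u : ℕ → Z n m) (k : ℕ) : Z n m :=
  extrapolate f μ (h₁ k) (uhat k) (iterate f μ h₁ h₂ z₀ uhat u k)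

/-- `zs` solves the weak Minty variational inequality on the whole space, with parameter `ρ`. -/
def IsWeakMinty {n m : ℕ} (F : Z n m → Z n m) (ρ : ℝ) (zs : Z n m) : Prop :=
  ∀ z, 0 ≤ inner ℝ (F z) (z - zs) + ρ / 2 * ‖F z‖ ^ 2

/-- Clarke's generalised directional derivative
`f°(z; v) = limsup_{z' → z, t ↓ 0} (f (z' + t v) - f z') / t`. -/
noncomputable def clarkeDeriv {n m : ℕ} (f : Z n m → ℝ) (z v : Z n m) : ℝ :=
  limsup (fun p : Z n m × ℝ => (f (p.1 + p.2 • v) - f p.1) / p.2) (𝓝 z ×ˢ 𝓝[>] (0 : ℝ))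

/-- Clarke's generalised gradient `∂f(z)`. -/
def clarkeGradient {n m : ℕ} (f : Z n m → ℝ) (z : Z n m) : Set (Z n m) :=
  {g | ∀ v, inner ℝ g v ≤ clarkeDeriv f z v}

/-- The `δ`-Goldstein subdifferential `∂_δ f(z)`. -/
def goldstein {n m : ℕ} (f : Z n m → ℝ) (δ : ℝ) (z : Z n m) : Set (Z n m) :=
  convexHull ℝ (⋃ z' ∈ Metric.closedBall z δ, clarkeGradient f z')

/-- The random point `X` is a `(δ, ε)`-Goldstein stationary point of `f` in expectation:
`E [min {‖g‖ : g ∈ ∂_δ f(X)}] ≤ ε`. The distance is the extended one, so that it would be `∞` for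
an empty subdifferential. -/
def IsGoldsteinStationaryInExpectation {n m : ℕ} {Ω : Type*} [MeasurableSpace Ω] (P : Measure Ω)
    (f : Z n m → ℝ) (δ ε : ℝ) (X : Ω → Z n m) : Prop :=
  ∫⁻ ω, Metric.infEDist 0 (goldstein f δ (X ω)) ∂P ≤ ENNReal.ofReal ε

end ZOEG

/-!
The smoothing `f_μ` is handled through two expressions for its gradient. By Rademacher's theorem and
dominated convergence, `∇f_μ(z) = E[∇f(z + μ u)]` (`hasGradientAt_integral_stdGaussian`).
Differentiating the Cameron–Martin formula instead gives Stein's identity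
`μ ∇f_μ(z) = E[f(z + μ u) u]` (`integral_smul_stdGaussian`), whence the Lipschitz constant
`√d L₀ / μ`, because `E‖u‖ ≤ √d`, and the fact that the oracle `G_μ` is an unbiased estimate of
`F_μ` (`integral_oracle`).

The first expression ties `f_μ` to the Goldstein subdifferential. Gradients of `f` at points of the
`δ`-ball around `z` belong to `∂_δ f(z)`, so that the mean of `∇f(z + μ u)` conditioned on
`‖μ u‖ ≤ δ` lies in its closure. It differs from `∇f_μ(z)` by at most `2 L₀ P(‖u‖ > δ / μ)`
(`infEDist_goldstein_le`), and a Chernoff bound with `E[exp (‖u‖² / 4)] = 2 ^ (d / 2)` shows that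
this is at most `ε / 4` for the prescribed `μ`.

It remains to find `k` with `E‖F_μ(ẑ_k)‖` at most `t = ε / 2 + √(3 / (L₁ (L₁ h₂² - ρ))) σ`. Fix a
point `z`, and let `g = F_μ(z) + ξ` be the oracle used in the extrapolation `ẑ = z - h₁ g`. The weak
Minty inequality at `ẑ` bounds the decrease of the squared distance to `z*` from below in terms of
`2 ⟨F_μ(ẑ), g⟩ - ‖F_μ(ẑ)‖²`. Comparing `ẑ` with the deterministic point `z - h₁ F_μ(z)`
(`norm_sq_sub_two_mul_inner_le`) bounds the opposite of that quantity by `3 ‖ξ‖²` plus a term that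
is linear in `ξ` and has mean zero; `L₁ h₁ ≤ 1` enters here. Thus, with
`c = h₁ h₂ - h₂² - h₂ ρ`,
`E‖z₊ - z*‖² + c E‖F_μ(ẑ)‖² ≤ ‖z - z*‖² + (h₂² + 3 h₁ h₂) σ²` (`extragradient_step`). As `z_k` is
independent of the directions of step `k`, this can be integrated over the law of `z_k` and
summed over `k`; the step size conditions turn the resulting bound on the smallest
`E‖F_μ(ẑ_k)‖²` into `t²` (`stepsize_bounds`, `average_bound_le_sq`).
-/

/-! ### The standard Gaussian measure -/

section Gaussian

variable {E : Type*} [NormedAddCommGroup E] [InnerProductSpace ℝ E]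

variable (E) in
/-- The Lebesgue density `(2π)^(-d/2) exp (-‖x‖² / 2)` of the standard Gaussian measure. -/
noncomputable def stdGaussianPDF (x : E) : ℝ :=
  (2 * Real.pi) ^ (-(Module.finrank ℝ E / 2 : ℝ)) * Real.exp (-‖x‖ ^ 2 / 2)

lemma stdGaussianPDF_pos (x : E) : 0 < stdGaussianPDF E x := by
  unfold stdGaussianPDF; positivity

lemma continuous_stdGaussianPDF : Continuous (stdGaussianPDF E) := by
  unfold stdGaussianPDF; fun_prop

lemma stdGaussianPDF_mul_exp (x : E) :
    stdGaussianPDF E x * Real.exp (‖x‖ ^ 2 / 4) =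
      (2 * Real.pi) ^ (-(Module.finrank ℝ E / 2 : ℝ)) * Real.exp (-(1 / 4) * ‖x‖ ^ 2) := by
  rw [stdGaussianPDF, mul_assoc, ← Real.exp_add]
  congr 2
  ring

variable [FiniteDimensional ℝ E] [MeasurableSpace E] [BorelSpace E]

lemma integrable_exp_neg_mul_sq_norm {b : ℝ} (hb : 0 < b) :
    Integrable (fun x : E => Real.exp (-b * ‖x‖ ^ 2)) := by
  have h := (GaussianFourier.integrable_cexp_neg_mul_sq_norm_add (b := (b : ℂ))
    (by simpa using hb) 0 (0 : E)).re
  refine h.congr (ae_of_all _ fun x => ?_)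
  simp only [zero_mul, add_zero]
  norm_cast

lemma integrable_stdGaussianPDF : Integrable (stdGaussianPDF E) := by
  unfold stdGaussianPDF
  refine Integrable.const_mul ?_ _
  convert integrable_exp_neg_mul_sq_norm (E := E) (b := 1 / 2) (by norm_num) using 3
  ring

variable (E) in
/-- Both measures have the characteristic function `t ↦ exp (-‖t‖² / 2)`. -/
theorem stdGaussian_eq_withDensity :
    stdGaussian E = volume.withDensity (fun x => ENNReal.ofReal (stdGaussianPDF E x)) := by
  have : IsFiniteMeasure (volume.withDensity fun x => ENNReal.ofReal (stdGaussianPDF E x)) :=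
    isFiniteMeasure_withDensity_ofReal integrable_stdGaussianPDF.2
  refine Measure.ext_of_charFun ?_
  ext t
  rw [charFun_stdGaussian, charFun_apply, integral_withDensity_eq_integral_toReal_smul
    (by exact continuous_stdGaussianPDF.measurable.ennreal_ofReal) (by simp)]
  have h := GaussianFourier.integral_cexp_neg_mul_sq_norm_add (V := E) (b := 1 / 2)
    (by norm_num) Complex.I t
  have hc : ∀ x : E, (ENNReal.ofReal (stdGaussianPDF E x)).toReal •
      Complex.exp (inner ℝ x t * Complex.I) =
      (((2 * Real.pi) ^ (-(Module.finrank ℝ E / 2 : ℝ)) : ℝ) : ℂ) *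
        Complex.exp (-(1 / 2) * ‖x‖ ^ 2 + Complex.I * inner ℝ t x) := by
    intro x
    rw [ENNReal.toReal_ofReal (stdGaussianPDF_pos x).le, stdGaussianPDF, Complex.real_smul,
      Complex.exp_add, real_inner_comm t x]
    push_cast
    rw [show -(‖x‖ : ℂ) ^ 2 / 2 = -(1 / 2) * ‖x‖ ^ 2 by ring,
      mul_comm Complex.I]
    ring
  simp_rw [hc]
  rw [integral_const_mul, h, ← mul_assoc]
  have h1 : (((2 * Real.pi) ^ (-(Module.finrank ℝ E / 2 : ℝ)) : ℝ) : ℂ) *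
      ((Real.pi : ℂ) / (1 / 2)) ^ ((Module.finrank ℝ E : ℂ) / 2) = 1 := by
    have h2 : ((Real.pi : ℂ) / (1 / 2)) ^ ((Module.finrank ℝ E : ℂ) / 2) =
        (((2 * Real.pi) ^ ((Module.finrank ℝ E / 2 : ℝ)) : ℝ) : ℂ) := by
      rw [Complex.ofReal_cpow (by positivity)]
      push_cast
      congr 1
      ring
    rw [h2, ← Complex.ofReal_mul, ← Real.rpow_add (by positivity)]
    simp
  rw [h1, one_mul, Complex.I_sq]
  congr 1
  ring

lemma stdGaussian_absolutelyContinuous_volume : stdGaussian E ≪ volume := by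
  rw [stdGaussian_eq_withDensity]
  exact withDensity_absolutelyContinuous _ _

lemma volume_absolutelyContinuous_stdGaussian : (volume : Measure E) ≪ stdGaussian E := by
  rw [stdGaussian_eq_withDensity]
  exact withDensity_absolutelyContinuous'
    continuous_stdGaussianPDF.measurable.ennreal_ofReal.aemeasurable
    (ae_of_all _ fun x => by simpa using stdGaussianPDF_pos x)

lemma integral_stdGaussian {G : Type*} [NormedAddCommGroup G] [NormedSpace ℝ G] (g : E → G) :
    ∫ x, g x ∂(stdGaussian E) = ∫ x, stdGaussianPDF E x • g x := by
  rw [stdGaussian_eq_withDensity, integral_withDensity_eq_integral_toReal_smul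
    (by exact continuous_stdGaussianPDF.measurable.ennreal_ofReal) (by simp)]
  simp only [ENNReal.toReal_ofReal (stdGaussianPDF_pos _).le]

/-- The Cameron–Martin formula for the standard Gaussian measure. -/
theorem integral_stdGaussian_add (g : E → ℝ) (v : E) :
    ∫ u, g (u + v) ∂(stdGaussian E) =
      ∫ u, g u * Real.exp (inner ℝ u v - ‖v‖ ^ 2 / 2) ∂(stdGaussian E) := by
  rw [integral_stdGaussian, integral_stdGaussian]
  rw [← integral_add_right_eq_self
    (fun u => stdGaussianPDF E u • (g u * Real.exp (inner ℝ u v - ‖v‖ ^ 2 / 2))) v]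
  refine integral_congr_ae (ae_of_all _ fun u => ?_)
  simp only [stdGaussianPDF, smul_eq_mul]
  have h : Real.exp (-‖u‖ ^ 2 / 2) =
      Real.exp (-‖u + v‖ ^ 2 / 2) * Real.exp (inner ℝ (u + v) v - ‖v‖ ^ 2 / 2) := by
    rw [← Real.exp_add, inner_add_left, real_inner_self_eq_norm_sq, norm_add_sq_real]
    congr 1
    ring
  rw [h]
  ring

lemma integrable_exp_sq_stdGaussian :
    Integrable (fun u : E => Real.exp (‖u‖ ^ 2 / 4)) (stdGaussian E) := by
  rw [stdGaussian_eq_withDensity, integrable_withDensity_iff_integrable_smul'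
    (by exact continuous_stdGaussianPDF.measurable.ennreal_ofReal) (by simp)]
  simp only [ENNReal.toReal_ofReal (stdGaussianPDF_pos _).le, smul_eq_mul, stdGaussianPDF_mul_exp]
  exact (integrable_exp_neg_mul_sq_norm (by norm_num)).const_mul _

lemma integral_exp_sq_stdGaussian :
    ∫ u : E, Real.exp (‖u‖ ^ 2 / 4) ∂(stdGaussian E) = 2 ^ (Module.finrank ℝ E / 2 : ℝ) := by
  rw [integral_stdGaussian]
  simp only [smul_eq_mul, stdGaussianPDF_mul_exp]
  rw [integral_const_mul, GaussianFourier.integral_rexp_neg_mul_sq_norm (by norm_num),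
    show Real.pi / (1 / 4) = 2 * (2 * Real.pi) by ring,
    Real.mul_rpow (x := 2) (y := 2 * Real.pi) (by norm_num) (by positivity),
    mul_left_comm, ← Real.rpow_add (x := 2 * Real.pi) (by positivity)]
  simp

/-- A Chernoff bound for the Gaussian tail. -/
lemma stdGaussian_real_norm_gt_le (R : ℝ) (hR : 0 ≤ R) :
    (stdGaussian E).real {u | R < ‖u‖} ≤
      2 ^ (Module.finrank ℝ E / 2 : ℝ) * Real.exp (-(R ^ 2 / 4)) := by
  have h := mul_meas_ge_le_integral_of_nonneg (μ := stdGaussian E)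
    (f := fun u : E => Real.exp (‖u‖ ^ 2 / 4)) (ae_of_all _ fun u => (Real.exp_pos _).le)
    integrable_exp_sq_stdGaussian (Real.exp (R ^ 2 / 4))
  rw [integral_exp_sq_stdGaussian] at h
  have h2 : (stdGaussian E).real {u | R < ‖u‖} ≤
      (stdGaussian E).real {u | Real.exp (R ^ 2 / 4) ≤ Real.exp (‖u‖ ^ 2 / 4)} := by
    refine measureReal_mono fun u hu => ?_
    simp only [Set.mem_ofPred_eq] at hu ⊢
    gcongr
  rw [Real.exp_neg, ← div_eq_mul_inv, le_div_iff₀ (Real.exp_pos _), mul_comm]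
  exact (mul_le_mul_of_nonneg_left h2 (Real.exp_pos _).le).trans h

lemma integrable_norm_pow_stdGaussian (k : ℕ) :
    Integrable (fun u : E => ‖u‖ ^ k) (stdGaussian E) := by
  have h : MemLp id (k : ENNReal) (stdGaussian E) := IsGaussian.memLp_id _ _ (by simp)
  simpa using h.integrable_norm_pow'

lemma integrable_id_stdGaussian : Integrable (fun u : E => u) (stdGaussian E) :=
  IsGaussian.integrable_fun_id

lemma integral_norm_sq_stdGaussian :
    ∫ u : E, ‖u‖ ^ 2 ∂(stdGaussian E) = Module.finrank ℝ E := by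
  have h1 : ∀ i, ∫ u : E, inner ℝ (stdOrthonormalBasis ℝ E i) u ^ 2 ∂(stdGaussian E) = 1 := by
    intro i
    have h := variance_dual_stdGaussian (innerSL ℝ (stdOrthonormalBasis ℝ E i))
    rw [variance_of_integral_eq_zero (by fun_prop) (integral_strongDual_stdGaussian _)] at h
    simpa using h
  have h2 : ∀ u : E, ‖u‖ ^ 2 = ∑ i, inner ℝ (stdOrthonormalBasis ℝ E i) u ^ 2 := fun u =>
    ((stdOrthonormalBasis ℝ E).sum_sq_inner_right u).symm
  simp_rw [h2]
  rw [integral_finsetSum]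
  · simp [h1]
  · intro i _
    refine (integrable_norm_pow_stdGaussian 2).mono' (by fun_prop) (ae_of_all _ fun u => ?_)
    rw [norm_pow]
    gcongr
    simpa using norm_inner_le_norm (𝕜 := ℝ) (stdOrthonormalBasis ℝ E i) u

lemma integral_norm_stdGaussian_le :
    ∫ u : E, ‖u‖ ∂(stdGaussian E) ≤ √(Module.finrank ℝ E) := by
  refine Real.le_sqrt_of_sq_le ?_
  rw [← integral_norm_sq_stdGaussian (E := E)]
  have h : MemLp (fun u : E => ‖u‖) 2 (stdGaussian E) :=
    (IsGaussian.memLp_two_id (μ := stdGaussian E)).norm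
  have := variance_nonneg (fun u : E => ‖u‖) (stdGaussian E)
  rw [variance_eq_sub h] at this
  simpa using this

end Gaussian

/-! ### Gaussian smoothing of a Lipschitz function -/

section Smoothing

variable {E : Type*} [NormedAddCommGroup E] [InnerProductSpace ℝ E] {f : E → ℝ} {K : NNReal}

lemma abs_apply_add_smul_le (hf : LipschitzWith K f) {μ : ℝ} (hμ : 0 ≤ μ) (z u : E) :
    |f (z + μ • u)| ≤ |f z| + K * μ * ‖u‖ := by
  have h := hf.norm_sub_le (z + μ • u) z
  rw [add_sub_cancel_left, norm_smul, Real.norm_of_nonneg hμ, Real.norm_eq_abs] at h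
  have := abs_sub_abs_le_abs_sub (f (z + μ • u)) (f z)
  nlinarith

variable [FiniteDimensional ℝ E]

lemma norm_gradient_le_of_lipschitz (hf : LipschitzWith K f) (x : E) : ‖gradient f x‖ ≤ K := by
  rw [gradient, LinearIsometryEquiv.norm_map]
  exact norm_fderiv_le_of_lipschitz ℝ hf

variable [MeasurableSpace E] [BorelSpace E]

lemma measurable_gradient : Measurable (gradient f) :=
  (InnerProductSpace.toDual ℝ E).symm.continuous.measurable.comp (measurable_fderiv ℝ f)

/-- Rademacher's theorem along the Gaussian perturbations of a point: `u ↦ f (z + μ u)` is Lipschitz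
and differentiable where `f` is differentiable at `z + μ u`. -/
lemma ae_differentiableAt_add_smul_stdGaussian (hf : LipschitzWith K f) {μ : ℝ} (hμ : μ ≠ 0)
    (z : E) : ∀ᵐ u ∂(stdGaussian E), DifferentiableAt ℝ f (z + μ • u) := by
  have hg : LipschitzWith (K * ‖μ‖₊) fun u : E => f (z + μ • u) := by
    refine hf.comp (LipschitzWith.of_dist_le_mul fun x y => ?_)
    simp [dist_eq_norm, ← smul_sub, norm_smul]
  filter_upwards [stdGaussian_absolutelyContinuous_volume.ae_le hg.ae_differentiableAt] with u hu
  have hc : f = (fun u : E => f (z + μ • u)) ∘ fun w => μ⁻¹ • (w - z) := by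
    ext w
    simp [smul_smul, mul_inv_cancel₀ hμ]
  rw [hc]
  refine DifferentiableAt.comp _ ?_ (by fun_prop)
  simpa [smul_smul, inv_mul_cancel₀ hμ] using hu

lemma integrable_apply_add_smul_stdGaussian (hf : LipschitzWith K f) {μ : ℝ} (hμ : 0 ≤ μ) (z : E) :
    Integrable (fun u => f (z + μ • u)) (stdGaussian E) := by
  have hi : Integrable (fun u : E => ‖u‖) (stdGaussian E) := integrable_id_stdGaussian.norm
  refine ((integrable_const |f z|).add (hi.const_mul (K * μ))).mono' ?_
    (ae_of_all _ fun u => abs_apply_add_smul_le hf hμ z u)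
  have := hf.continuous
  exact Continuous.aestronglyMeasurable (by fun_prop)

lemma integrable_gradient_add_smul_stdGaussian (hf : LipschitzWith K f) (μ : ℝ) (z : E) :
    Integrable (fun u => gradient f (z + μ • u)) (stdGaussian E) :=
  (integrable_const (K : ℝ)).mono'
    (measurable_gradient.comp (by fun_prop)).aestronglyMeasurable
    (ae_of_all _ fun _ => norm_gradient_le_of_lipschitz hf _)

/-- The smoothing of a Lipschitz function is differentiable, and its gradient is the average of the
almost everywhere defined gradient of the function. -/
theorem hasGradientAt_integral_stdGaussian (hf : LipschitzWith K f) {μ : ℝ} (hμ : 0 < μ) (z : E) :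
    HasGradientAt (fun z => ∫ u, f (z + μ • u) ∂(stdGaussian E))
      (∫ u, gradient f (z + μ • u) ∂(stdGaussian E)) z := by
  rw [hasGradientAt_iff_hasFDerivAt]
  have hcont := hf.continuous
  have h := (hasFDerivAt_integral_of_dominated_loc_of_lip (𝕜 := ℝ) (μ := stdGaussian E)
    (F := fun z u => f (z + μ • u)) (x₀ := z) (s := Set.univ)
    (F' := fun u => fderiv ℝ f (z + μ • u)) (bound := fun _ => (K : ℝ)) univ_mem
    (Eventually.of_forall fun x => Continuous.aestronglyMeasurable (by fun_prop))
    (integrable_apply_add_smul_stdGaussian hf hμ.le z)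
    ((measurable_fderiv ℝ f).comp (by fun_prop)).aestronglyMeasurable
    (ae_of_all _ fun u => ?_) (integrable_const _) ?_).2
  · have he : InnerProductSpace.toDual ℝ E (∫ u, gradient f (z + μ • u) ∂(stdGaussian E)) =
        ∫ u, fderiv ℝ f (z + μ • u) ∂(stdGaussian E) := by
      have := (InnerProductSpace.toDual ℝ E).toContinuousLinearEquiv.integral_comp_comm
        (μ := stdGaussian E) (fun u => gradient f (z + μ • u))
      simpa [gradient] using this.symm
    rw [he]
    exact h
  · refine LipschitzWith.lipschitzOnWith (LipschitzWith.of_dist_le_mul fun x y => ?_)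
    simpa using hf.dist_le_mul (x + μ • u) (y + μ • u)
  · filter_upwards [ae_differentiableAt_add_smul_stdGaussian hf hμ.ne' z] with u hu
    have := hu.hasFDerivAt.comp (f := fun x : E => x + μ • u) z
      ((hasFDerivAt_id z).add_const (μ • u))
    simpa [Function.comp_def] using this

lemma gradient_integral_stdGaussian (hf : LipschitzWith K f) {μ : ℝ} (hμ : 0 < μ) (z : E) :
    gradient (fun z => ∫ u, f (z + μ • u) ∂(stdGaussian E)) z =
      ∫ u, gradient f (z + μ • u) ∂(stdGaussian E) :=
  (hasGradientAt_integral_stdGaussian hf hμ z).gradient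

lemma integrable_exp_mul_norm_stdGaussian (c : ℝ) :
    Integrable (fun u : E => Real.exp (c * ‖u‖)) (stdGaussian E) := by
  refine (integrable_exp_sq_stdGaussian.const_mul (Real.exp (c ^ 2))).mono'
    (Continuous.aestronglyMeasurable (by fun_prop)) (ae_of_all _ fun u => ?_)
  rw [Real.norm_of_nonneg (Real.exp_pos _).le, ← Real.exp_add]
  gcongr
  nlinarith [sq_nonneg (c - ‖u‖ / 2)]

/-- Stein's identity in a direction `v`, obtained by differentiating the Cameron–Martin formula for
the translations by `t v` at `t = 0`. -/
lemma integral_mul_inner_stdGaussian (hf : LipschitzWith K f) {μ : ℝ} (hμ : 0 < μ) (z v : E) :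
    ∫ u, f (z + μ • u) * inner ℝ u v ∂(stdGaussian E) =
      μ * inner ℝ (gradient (fun z => ∫ u, f (z + μ • u) ∂(stdGaussian E)) z) v := by
  have hcont := hf.continuous
  set S : E → ℝ := fun z => ∫ u, f (z + μ • u) ∂(stdGaussian E) with hS
  have hphi : (fun t : ℝ => S (z + t • μ • v)) = fun t : ℝ => ∫ u, f (z + μ • u) *
      Real.exp (t * inner ℝ u v - t ^ 2 * (‖v‖ ^ 2 / 2)) ∂(stdGaussian E) := by
    ext t
    have h := integral_stdGaussian_add (fun u : E => f (z + μ • u)) (t • v)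
    have h1 : ∀ u : E, z + t • μ • v + μ • u = z + μ • (u + t • v) := fun u => by
      rw [smul_add, smul_comm t μ v]; abel
    simp only [hS, h1, h, real_inner_smul_right, norm_smul, mul_pow, Real.norm_eq_abs, sq_abs,
      mul_div_assoc]
  have hd1 : HasDerivAt (fun t : ℝ => S (z + t • μ • v)) (μ * inner ℝ (gradient S z) v) 0 := by
    have hg := hasGradientAt_integral_stdGaussian hf hμ z
    have hg' : HasFDerivAt S (InnerProductSpace.toDual ℝ E (gradient S z))
        (z + (0 : ℝ) • μ • v) := by
      rw [zero_smul, add_zero, ← hasGradientAt_iff_hasFDerivAt]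
      exact hg.differentiableAt.hasGradientAt
    have hl : HasDerivAt (fun t : ℝ => z + t • μ • v) (μ • v) 0 := by
      simpa using ((hasDerivAt_id (0 : ℝ)).smul_const (μ • v)).const_add z
    have := hg'.comp_hasDerivAt (0 : ℝ) hl
    simpa [real_inner_smul_right, Function.comp_def] using this
  have hd2 := (hasDerivAt_integral_of_dominated_loc_of_deriv_le (𝕜 := ℝ) (μ := stdGaussian E)
    (F := fun (t : ℝ) u => f (z + μ • u) *
      Real.exp (t * inner ℝ u v - t ^ 2 * (‖v‖ ^ 2 / 2)))
    (F' := fun (t : ℝ) u => f (z + μ • u) *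
      (Real.exp (t * inner ℝ u v - t ^ 2 * (‖v‖ ^ 2 / 2)) * (inner ℝ u v - t * ‖v‖ ^ 2)))
    (x₀ := (0 : ℝ)) (s := Metric.ball 0 1)
    (bound := fun u => (|f z| + K * μ) * (‖v‖ + ‖v‖ ^ 2) * Real.exp ((‖v‖ + 2) * ‖u‖))
    (Metric.ball_mem_nhds _ one_pos)
    (Eventually.of_forall fun x => Continuous.aestronglyMeasurable (by fun_prop))
    (by simpa using integrable_apply_add_smul_stdGaussian hf hμ.le z)
    (Continuous.aestronglyMeasurable (by fun_prop))
    (ae_of_all _ fun u t ht => ?_)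
    ((integrable_exp_mul_norm_stdGaussian _).const_mul _)
    (ae_of_all _ fun u t _ => ?_)).2
  · rw [← hphi] at hd2
    have h := hd2.unique hd1
    simpa using h
  -- domination of the derivative in `t`: the affine factors are absorbed by `1 + ‖u‖ ≤ exp ‖u‖`
  · have ht1 : |t| ≤ 1 := by
      rw [mem_ball_zero_iff, Real.norm_eq_abs] at ht; exact ht.le
    have hi : |inner ℝ u v| ≤ ‖u‖ * ‖v‖ := abs_real_inner_le_norm u v
    have hexp : 1 + ‖u‖ ≤ Real.exp ‖u‖ := by linarith [Real.add_one_le_exp ‖u‖]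
    have hu := norm_nonneg u
    have hv := norm_nonneg v
    have hfz := abs_nonneg (f z)
    have h1 : |f (z + μ • u)| ≤ (|f z| + K * μ) * Real.exp ‖u‖ := by
      have hb : 0 ≤ K * μ := by positivity
      calc |f (z + μ • u)| ≤ |f z| + K * μ * ‖u‖ := abs_apply_add_smul_le hf hμ.le z u
        _ ≤ (|f z| + K * μ) * (1 + ‖u‖) := by nlinarith
        _ ≤ _ := by gcongr
    have h2 : |inner ℝ u v - t * ‖v‖ ^ 2| ≤ (‖v‖ + ‖v‖ ^ 2) * Real.exp ‖u‖ := by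
      calc |inner ℝ u v - t * ‖v‖ ^ 2| ≤ |inner ℝ u v| + |t * ‖v‖ ^ 2| := abs_sub _ _
        _ ≤ ‖u‖ * ‖v‖ + 1 * ‖v‖ ^ 2 := by
          rw [abs_mul, abs_of_nonneg (sq_nonneg ‖v‖)]; gcongr
        _ ≤ (‖v‖ + ‖v‖ ^ 2) * (1 + ‖u‖) := by
          nlinarith [mul_nonneg hu (sq_nonneg ‖v‖)]
        _ ≤ _ := by gcongr
    have h3 : Real.exp (t * inner ℝ u v - t ^ 2 * (‖v‖ ^ 2 / 2)) ≤ Real.exp (‖v‖ * ‖u‖) := by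
      gcongr
      have : t * inner ℝ u v ≤ 1 * (‖u‖ * ‖v‖) :=
        (le_abs_self _).trans (by rw [abs_mul]; gcongr)
      nlinarith [mul_nonneg (sq_nonneg t) (sq_nonneg ‖v‖)]
    rw [Real.norm_eq_abs, abs_mul, abs_mul, Real.abs_exp]
    calc |f (z + μ • u)| * (Real.exp (t * inner ℝ u v - t ^ 2 * (‖v‖ ^ 2 / 2)) *
          |inner ℝ u v - t * ‖v‖ ^ 2|)
        ≤ (|f z| + K * μ) * Real.exp ‖u‖ *
          (Real.exp (‖v‖ * ‖u‖) * ((‖v‖ + ‖v‖ ^ 2) * Real.exp ‖u‖)) := by gcongr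
      _ = _ := by
        rw [show (‖v‖ + 2) * ‖u‖ = ‖u‖ + ‖v‖ * ‖u‖ + ‖u‖ by ring, Real.exp_add, Real.exp_add]
        ring
  · refine HasDerivAt.const_mul _ (HasDerivAt.exp ?_)
    refine (((hasDerivAt_id t).mul_const (inner ℝ u v)).sub
      ((hasDerivAt_pow 2 t).mul_const (‖v‖ ^ 2 / 2))).congr_deriv ?_
    push_cast
    ring

lemma integrable_smul_stdGaussian (hf : LipschitzWith K f) {μ : ℝ} (hμ : 0 ≤ μ) (z : E) :
    Integrable (fun u => f (z + μ • u) • u) (stdGaussian E) := by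
  have hcont := hf.continuous
  refine ((integrable_id_stdGaussian.norm.const_mul |f z|).add
    ((integrable_norm_pow_stdGaussian (E := E) 2).const_mul (K * μ))).mono'
    (Continuous.aestronglyMeasurable (by fun_prop)) (ae_of_all _ fun u => ?_)
  rw [norm_smul, Real.norm_eq_abs]
  calc |f (z + μ • u)| * ‖u‖ ≤ (|f z| + K * μ * ‖u‖) * ‖u‖ := by
        gcongr; exact abs_apply_add_smul_le hf hμ z u
    _ = _ := by simp only [Pi.add_apply]; ring

/-- Stein's identity: the gradient of the smoothing does not involve the gradient of `f`. -/
theorem integral_smul_stdGaussian (hf : LipschitzWith K f) {μ : ℝ} (hμ : 0 < μ) (z : E) :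
    ∫ u, f (z + μ • u) • u ∂(stdGaussian E) =
      μ • gradient (fun z => ∫ u, f (z + μ • u) ∂(stdGaussian E)) z := by
  refine ext_inner_right ℝ fun v => ?_
  rw [real_inner_smul_left, ← integral_mul_inner_stdGaussian hf hμ, real_inner_comm,
    ← integral_inner (integrable_smul_stdGaussian hf hμ.le z)]
  simp only [real_inner_smul_right, real_inner_comm]

theorem norm_gradient_sub_integral_stdGaussian_le (hf : LipschitzWith K f) {μ : ℝ} (hμ : 0 < μ)
    (x y : E) :
    ‖gradient (fun z => ∫ u, f (z + μ • u) ∂(stdGaussian E)) x -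
        gradient (fun z => ∫ u, f (z + μ • u) ∂(stdGaussian E)) y‖ ≤
      √(Module.finrank ℝ E) * K / μ * ‖x - y‖ := by
  have h : μ * ‖gradient (fun z => ∫ u, f (z + μ • u) ∂(stdGaussian E)) x -
        gradient (fun z => ∫ u, f (z + μ • u) ∂(stdGaussian E)) y‖ ≤
      K * ‖x - y‖ * √(Module.finrank ℝ E) := by
    rw [← Real.norm_of_nonneg hμ.le, ← norm_smul, Real.norm_of_nonneg hμ.le, smul_sub,
      ← integral_smul_stdGaussian hf hμ, ← integral_smul_stdGaussian hf hμ,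
      ← integral_sub (integrable_smul_stdGaussian hf hμ.le x)
        (integrable_smul_stdGaussian hf hμ.le y)]
    calc _ ≤ ∫ u : E, K * ‖x - y‖ * ‖u‖ ∂(stdGaussian E) := by
          refine norm_integral_le_of_norm_le (integrable_id_stdGaussian.norm.const_mul _)
            (ae_of_all _ fun u => ?_)
          rw [← sub_smul, norm_smul]
          gcongr
          simpa using hf.norm_sub_le (x + μ • u) (y + μ • u)
      _ ≤ _ := by
          rw [integral_const_mul]
          gcongr
          exact integral_norm_stdGaussian_le
  calc _ ≤ K * ‖x - y‖ * √(Module.finrank ℝ E) / μ := by rwa [le_div_iff₀' hμ]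
    _ = _ := by ring

end Smoothing

/-! ### Clarke and Goldstein subdifferentials -/

section Goldstein

variable {n m : ℕ} {f : ZOEG.Z n m → ℝ} {K : NNReal}

/-- Letting only `t` vary in the upper limit that defines Clarke's derivative gives the ordinary
directional derivative, which is therefore at most Clarke's. -/
lemma gradient_mem_clarkeGradient (hf : LipschitzWith K f) {z : ZOEG.Z n m}
    (hz : DifferentiableAt ℝ f z) : gradient f z ∈ ZOEG.clarkeGradient f z := by
  intro v
  set q : ZOEG.Z n m × ℝ → ℝ := fun p => (f (p.1 + p.2 • v) - f p.1) / p.2 with hq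
  have hbound : ∀ᶠ p in 𝓝 z ×ˢ 𝓝[>] (0 : ℝ), q p ≤ K * ‖v‖ := by
    have h0 : ∀ᶠ p in 𝓝 z ×ˢ 𝓝[>] (0 : ℝ), 0 < p.2 :=
      tendsto_snd.eventually self_mem_nhdsWithin
    filter_upwards [h0] with p hp
    rw [hq, div_le_iff₀ hp]
    have h := hf.norm_sub_le (p.1 + p.2 • v) p.1
    rw [add_sub_cancel_left, norm_smul, Real.norm_of_nonneg hp.le] at h
    calc _ ≤ ‖f (p.1 + p.2 • v) - f p.1‖ := le_abs_self _
      _ ≤ _ := h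
      _ = _ := by ring
  have hlim : Tendsto q (pure z ×ˢ 𝓝[>] (0 : ℝ)) (𝓝 (inner ℝ (gradient f z) v)) := by
    rw [pure_prod, tendsto_map'_iff]
    have h := (hz.hasFDerivAt.hasLineDerivAt v).tendsto_slope_zero_right
    rw [← InnerProductSpace.toDual_symm_apply] at h
    refine h.congr fun t => ?_
    simp [hq, div_eq_inv_mul]
  calc inner ℝ (gradient f z) v = limsup q (pure z ×ˢ 𝓝[>] (0 : ℝ)) := hlim.limsup_eq.symm
    _ ≤ limsup q (𝓝 z ×ˢ 𝓝[>] (0 : ℝ)) :=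
      limsup_le_limsup_of_le (prod_mono_left _ (pure_le_nhds z)) hlim.isCoboundedUnder_le
        (isBoundedUnder_of_eventually_le hbound)

/-- The gradient of the smoothing is an average of gradients of `f`. Conditioning this average on
the directions `u` with `‖μ u‖ ≤ δ` gives a point of the closure of the Goldstein subdifferential,
and costs at most `2 K` times the probability of the other directions. -/
theorem infEDist_goldstein_le (hf : LipschitzWith K f) {μ δ : ℝ} (hμ : 0 < μ) (hδ : 0 < δ)
    (z : ZOEG.Z n m) :
    Metric.infEDist 0 (ZOEG.goldstein f δ z) ≤ ENNReal.ofReal (‖gradient (ZOEG.smooth f μ) z‖ +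
      2 * K * (stdGaussian (ZOEG.Z n m)).real {u | δ / μ < ‖u‖}) := by
  set γ := stdGaussian (ZOEG.Z n m) with hγ
  set S : Set (ZOEG.Z n m) := Metric.closedBall 0 (δ / μ) with hS
  have hSm : MeasurableSet S := Metric.isClosed_closedBall.measurableSet
  have hSc : Sᶜ = {u | δ / μ < ‖u‖} := by ext; simp [hS]
  have hS0 : γ S ≠ 0 := by
    intro h
    have h1 : volume S = 0 := volume_absolutelyContinuous_stdGaussian h
    exact (Metric.measure_closedBall_pos volume (0 : ZOEG.Z n m) (div_pos hδ hμ)).ne' h1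
  have hint := integrable_gradient_add_smul_stdGaussian hf μ z
  set g := ⨍ u in S, gradient f (z + μ • u) ∂γ with hg
  have hmem : ∀ u ∈ S, DifferentiableAt ℝ f (z + μ • u) →
      gradient f (z + μ • u) ∈ ZOEG.goldstein f δ z := by
    intro u hu hd
    refine subset_convexHull ℝ _ (Set.mem_biUnion ?_ (gradient_mem_clarkeGradient hf hd))
    rw [hS, mem_closedBall_zero_iff, le_div_iff₀' hμ] at hu
    simpa [norm_smul, abs_of_pos hμ] using hu
  have hgmem : g ∈ closure (ZOEG.goldstein f δ z) := by
    refine (convex_convexHull ℝ _).set_average_mem_closure hS0 (measure_ne_top _ _) ?_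
      hint.integrableOn
    filter_upwards [ae_restrict_mem hSm, ae_restrict_of_ae
      (ae_differentiableAt_add_smul_stdGaussian hf hμ.ne' z)] with u hu hd using hmem u hu hd
  have hp : 0 < γ.real S := ENNReal.toReal_pos hS0 (measure_ne_top _ _)
  have hpc : γ.real Sᶜ = 1 - γ.real S := probReal_compl_eq_one_sub hSm
  have hSg : ∫ u in S, gradient f (z + μ • u) ∂γ = γ.real S • g := by
    rw [hg, setAverage_eq, smul_inv_smul₀ hp.ne']
  have hbd : ∀ A : Set (ZOEG.Z n m), ‖∫ u in A, gradient f (z + μ • u) ∂γ‖ ≤ K * γ.real A :=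
    fun A => norm_setIntegral_le_of_norm_le_const (measure_lt_top _ _)
      fun u _ => norm_gradient_le_of_lipschitz hf _
  have hgK : ‖g‖ ≤ K := by
    have h := hbd S
    rw [hSg, norm_smul, Real.norm_of_nonneg hp.le, mul_comm] at h
    exact le_of_mul_le_mul_right h hp
  have hm : gradient (ZOEG.smooth f μ) z =
      γ.real S • g + ∫ u in Sᶜ, gradient f (z + μ • u) ∂γ := by
    rw [← hSg, integral_add_compl hSm hint]
    exact gradient_integral_stdGaussian hf hμ z
  have hgm : g = gradient (ZOEG.smooth f μ) z + γ.real Sᶜ • g -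
      ∫ u in Sᶜ, gradient f (z + μ • u) ∂γ := by
    rw [hm, hpc]
    module
  have hnorm : ‖g‖ ≤ ‖gradient (ZOEG.smooth f μ) z‖ + 2 * K * γ.real Sᶜ := by
    have h1 : ‖γ.real Sᶜ • g‖ ≤ K * γ.real Sᶜ := by
      rw [norm_smul, Real.norm_of_nonneg measureReal_nonneg, mul_comm]
      gcongr
    calc ‖g‖ = ‖gradient (ZOEG.smooth f μ) z + γ.real Sᶜ • g -
          ∫ u in Sᶜ, gradient f (z + μ • u) ∂γ‖ := congrArg _ hgm
      _ ≤ ‖gradient (ZOEG.smooth f μ) z‖ + ‖γ.real Sᶜ • g‖ +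
          ‖∫ u in Sᶜ, gradient f (z + μ • u) ∂γ‖ :=
        (norm_sub_le _ _).trans (add_le_add_left (norm_add_le _ _) _)
      _ ≤ _ := by linarith [hbd Sᶜ]
  rw [← Metric.infEDist_closure, ← hSc]
  refine (Metric.infEDist_le_edist_of_mem hgmem).trans ?_
  rw [edist_dist, dist_zero_left]
  exact ENNReal.ofReal_le_ofReal hnorm

/-- With `y = R² / (2 d)`, the claim reduces to `y exp (-y) ≤ 1` and `4 ≤ π e`. -/
lemma two_rpow_mul_exp_le_pow {d : ℕ} (hd : 0 < d) {R s : ℝ} (hR : 0 < R)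
    (h : √(d * Real.pi * Real.exp 1) ≤ R * s) :
    2 ^ (d / 2 : ℝ) * Real.exp (-(R ^ 2 / 4)) ≤ s ^ d := by
  have hd' : (0 : ℝ) < d := by exact_mod_cast hd
  have hbase : √2 * Real.exp (-(R ^ 2 / (4 * d))) ≤ s := by
    refine le_of_mul_le_mul_left (le_trans ?_ h) hR
    refine Real.le_sqrt_of_sq_le ?_
    have hy : R ^ 2 / (2 * d) * Real.exp (-(R ^ 2 / (2 * d))) ≤ 1 := by
      rw [Real.exp_neg, ← div_eq_mul_inv, div_le_one (Real.exp_pos _)]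
      linarith [Real.add_one_le_exp (R ^ 2 / (2 * d))]
    have hpi : (4 : ℝ) ≤ Real.pi * Real.exp 1 := by
      nlinarith [Real.pi_gt_three, Real.add_one_le_exp (1 : ℝ)]
    calc (R * (√2 * Real.exp (-(R ^ 2 / (4 * d))))) ^ 2
        = (4 * d : ℝ) * (R ^ 2 / (2 * d) * Real.exp (-(R ^ 2 / (2 * d)))) := by
          rw [mul_pow, mul_pow, Real.sq_sqrt (by norm_num), ← Real.exp_nat_mul,
            show ((2 : ℕ) : ℝ) * -(R ^ 2 / (4 * d)) = -(R ^ 2 / (2 * d)) by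
              push_cast; field_simp; norm_num]
          field_simp
          norm_num
      _ ≤ (4 * d : ℝ) * 1 := by gcongr
      _ ≤ d * Real.pi * Real.exp 1 := by nlinarith
  calc 2 ^ (d / 2 : ℝ) * Real.exp (-(R ^ 2 / 4))
      = (√2 * Real.exp (-(R ^ 2 / (4 * d)))) ^ d := by
        rw [mul_pow, ← Real.exp_nat_mul, Real.sqrt_eq_rpow,
          ← Real.rpow_natCast ((2 : ℝ) ^ (1 / 2 : ℝ)), ← Real.rpow_mul (by norm_num)]
        congr 2 <;> field_simp
    _ ≤ s ^ d := by gcongr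

/-- For a small enough smoothing parameter, passing from the smoothing to the Goldstein
subdifferential costs at most `ε / 4`. -/
lemma infEDist_goldstein_le_of_smoothing_le (hd : 0 < n + m) {L₀ : ℝ} (hL₀ : 0 < L₀)
    (hf : LipschitzWith L₀.toNNReal f) {μ δ ε : ℝ} (hμ : 0 < μ) (hδ : 0 < δ) (hε : 0 < ε)
    (h : μ ≤ δ / √(((n + m : ℕ) : ℝ) * Real.pi * Real.exp 1) *
      (ε / (8 * L₀)) ^ (1 / ((n + m : ℕ) : ℝ))) (z : ZOEG.Z n m) :
    Metric.infEDist 0 (ZOEG.goldstein f δ z) ≤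
      ENNReal.ofReal (‖gradient (ZOEG.smooth f μ) z‖ + ε / 4) := by
  refine (infEDist_goldstein_le hf hμ hδ z).trans (ENNReal.ofReal_le_ofReal ?_)
  have hd' : (0 : ℝ) < (n + m : ℕ) := by exact_mod_cast hd
  set s := (ε / (8 * L₀)) ^ (1 / ((n + m : ℕ) : ℝ)) with hs
  have hsd : s ^ (n + m) = ε / (8 * L₀) := by
    rw [hs, ← Real.rpow_natCast, ← Real.rpow_mul (by positivity), one_div,
      inv_mul_cancel₀ hd'.ne', Real.rpow_one]
  have hq : 0 < √(((n + m : ℕ) : ℝ) * Real.pi * Real.exp 1) := by positivity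
  have hRs : √(((n + m : ℕ) : ℝ) * Real.pi * Real.exp 1) ≤ δ / μ * s := by
    rw [div_mul_eq_mul_div, le_div_iff₀ hq] at h
    rw [div_mul_eq_mul_div, le_div_iff₀ hμ]
    linarith
  have hP := stdGaussian_real_norm_gt_le (E := ZOEG.Z n m) (δ / μ) (by positivity)
  have hfin : Module.finrank ℝ (ZOEG.Z n m) = n + m := by simp
  rw [hfin] at hP
  have hP2 := hP.trans (two_rpow_mul_exp_le_pow hd (by positivity) hRs)
  rw [hsd, le_div_iff₀ (by positivity)] at hP2
  rw [Real.coe_toNNReal _ hL₀.le]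
  linarith

end Goldstein

/-! ### One stochastic extragradient step -/

section OneStep

variable {A E : Type*} [MeasurableSpace A] {γ : Measure A} [IsProbabilityMeasure γ]
  [NormedAddCommGroup E] {F : E → E} {G : A → E → E} {L σ : ℝ}

lemma integrable_norm_sub_mean_sq (hG : ∀ z, MemLp (fun u => G u z) 2 γ) (z : E) :
    Integrable (fun u => ‖G u z - F z‖ ^ 2) γ :=
  ((hG z).sub (memLp_const (F z))).integrable_norm_pow two_ne_zero

variable [InnerProductSpace ℝ E]

/-- The error of an extragradient step, whose extrapolation uses the estimate `g` of `F z`. The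
inner product on the right has a first argument that does not depend on `g`, so that it averages
out when `g` is unbiased. -/
lemma norm_sq_sub_two_mul_inner_le (hF : ∀ x y, ‖F x - F y‖ ≤ L * ‖x - y‖) {h : ℝ} (hh : 0 ≤ h)
    (hL : L * h ≤ 1) (z g : E) :
    ‖F (z - h • g)‖ ^ 2 - 2 * inner ℝ (F (z - h • g)) g ≤
      3 * ‖g - F z‖ ^ 2 - 2 * inner ℝ (F (z - h • F z) - F z) (g - F z) := by
  have h1 : ‖F (z - h • g) - F z‖ ≤ ‖g‖ := by
    calc _ ≤ L * ‖z - h • g - z‖ := hF _ _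
      _ = L * h * ‖g‖ := by
        rw [sub_sub_cancel_left, norm_neg, norm_smul, Real.norm_of_nonneg hh, mul_assoc]
      _ ≤ 1 * ‖g‖ := by gcongr
      _ = ‖g‖ := one_mul _
  have h2 : ‖F (z - h • g) - F (z - h • F z)‖ ≤ ‖g - F z‖ := by
    calc _ ≤ L * ‖z - h • g - (z - h • F z)‖ := hF _ _
      _ = L * h * ‖g - F z‖ := by
        rw [show z - h • g - (z - h • F z) = -(h • (g - F z)) by module, norm_neg, norm_smul,
          Real.norm_of_nonneg hh, mul_assoc]
      _ ≤ 1 * ‖g - F z‖ := by gcongr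
      _ = ‖g - F z‖ := one_mul _
  have h3 : -(‖g - F z‖ ^ 2) ≤ inner ℝ (F (z - h • g) - F (z - h • F z)) (g - F z) := by
    have := (abs_le.1 (abs_real_inner_le_norm (F (z - h • g) - F (z - h • F z)) (g - F z))).1
    nlinarith [norm_nonneg (g - F z)]
  have h4 : ‖F (z - h • g) - F z‖ ^ 2 ≤ ‖g‖ ^ 2 := by gcongr
  have h5 : ‖F (z - h • g)‖ ^ 2 - 2 * inner ℝ (F (z - h • g)) g =
      ‖F (z - h • g) - F z‖ ^ 2 - ‖g‖ ^ 2 -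
        2 * inner ℝ (F (z - h • g) - F z) (g - F z) + ‖g - F z‖ ^ 2 := by
    simp only [← real_inner_self_eq_norm_sq, inner_sub_left, inner_sub_right]
    rw [real_inner_comm (F (z - h • g)) (F z), real_inner_comm (F z) g]
    ring
  have h6 : inner ℝ (F (z - h • g) - F z) (g - F z) =
      inner ℝ (F (z - h • g) - F (z - h • F z)) (g - F z) +
        inner ℝ (F (z - h • F z) - F z) (g - F z) := by
    rw [← inner_add_left, sub_add_sub_cancel]
  linarith

variable [FiniteDimensional ℝ E]

lemma integral_inner_sub_mean (hG : ∀ z, MemLp (fun u => G u z) 2 γ)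
    (hmean : ∀ z, ∫ u, G u z ∂γ = F z) (z a : E) :
    Integrable (fun u => inner ℝ a (G u z - F z)) γ ∧ ∫ u, inner ℝ a (G u z - F z) ∂γ = 0 := by
  have hi : Integrable (fun u => G u z) γ := (hG z).integrable one_le_two
  have h := hi.sub (integrable_const (F z))
  refine ⟨h.const_inner a, ?_⟩
  rw [show (∫ u, inner ℝ a (G u z - F z) ∂γ) = inner ℝ a (∫ u, (G u z - F z) ∂γ) from
    integral_inner h a, integral_sub hi (integrable_const _), hmean]
  simp

/-- A step along an unbiased estimate of `F z` instead of `F z` costs `h² σ²` in mean square. -/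
lemma lintegral_norm_sub_smul_sq_le (hG : ∀ z, MemLp (fun u => G u z) 2 γ)
    (hmean : ∀ z, ∫ u, G u z ∂γ = F z) (hvar : ∀ z, ∫ u, ‖G u z - F z‖ ^ 2 ∂γ ≤ σ ^ 2)
    (h : ℝ) (w z : E) :
    ∫⁻ u, ENNReal.ofReal (‖w - h • G u z‖ ^ 2) ∂γ ≤
      ENNReal.ofReal (‖w - h • F z‖ ^ 2 + h ^ 2 * σ ^ 2) := by
  obtain ⟨hi, h0⟩ := integral_inner_sub_mean hG hmean z (w - h • F z)
  have hv := integrable_norm_sub_mean_sq (F := F) hG z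
  have hexp : ∀ u, ‖w - h • G u z‖ ^ 2 = ‖w - h • F z‖ ^ 2 -
      2 * h * inner ℝ (w - h • F z) (G u z - F z) + h ^ 2 * ‖G u z - F z‖ ^ 2 := by
    intro u
    rw [show w - h • G u z = (w - h • F z) - h • (G u z - F z) by module, norm_sub_sq_real,
      real_inner_smul_right, norm_smul, mul_pow, Real.norm_eq_abs, sq_abs]
    ring
  have hI1 : Integrable (fun u => ‖w - h • F z‖ ^ 2 -
      2 * h * inner ℝ (w - h • F z) (G u z - F z)) γ :=
    (integrable_const _).sub (hi.const_mul _)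
  have hint : Integrable (fun u => ‖w - h • G u z‖ ^ 2) γ := by
    simp_rw [hexp]
    exact hI1.add (hv.const_mul _)
  rw [← ofReal_integral_eq_lintegral_ofReal hint (ae_of_all _ fun u => sq_nonneg _)]
  refine ENNReal.ofReal_le_ofReal ?_
  simp_rw [hexp]
  rw [integral_add hI1 (hv.const_mul _), integral_sub (integrable_const _) (hi.const_mul _),
    integral_const_mul, integral_const_mul, h0]
  simp only [integral_const, probReal_univ, one_smul, mul_zero, sub_zero]
  gcongr
  exact hvar z

variable [MeasurableSpace E] [BorelSpace E]

/-- The expected decrease of the distance to a weak Minty solution in one stochastic extragradient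
step from a fixed point `z`. -/
theorem extragradient_step (hF : ∀ x y, ‖F x - F y‖ ≤ L * ‖x - y‖) (hFm : Measurable F)
    (hGm : ∀ z, Measurable fun u => G u z) (hG : ∀ z, MemLp (fun u => G u z) 2 γ)
    (hmean : ∀ z, ∫ u, G u z ∂γ = F z) (hvar : ∀ z, ∫ u, ‖G u z - F z‖ ^ 2 ∂γ ≤ σ ^ 2)
    {ρ : ℝ} {zs : E} (hzs : ∀ z, 0 ≤ inner ℝ (F z) (z - zs) + ρ / 2 * ‖F z‖ ^ 2)
    {h₁ h₂ : ℝ} (hh₁ : 0 ≤ h₁) (hh₂ : 0 ≤ h₂) (hL : L * h₁ ≤ 1)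
    (hc : 0 ≤ h₁ * h₂ - h₂ ^ 2 - h₂ * ρ) (z : E) :
    ∫⁻ v, ∫⁻ u, ENNReal.ofReal (‖z - h₂ • G u (z - h₁ • G v z) - zs‖ ^ 2) ∂γ ∂γ +
      ENNReal.ofReal (h₁ * h₂ - h₂ ^ 2 - h₂ * ρ) *
        ∫⁻ v, ENNReal.ofReal (‖F (z - h₁ • G v z)‖ ^ 2) ∂γ ≤
      ENNReal.ofReal (‖z - zs‖ ^ 2) + ENNReal.ofReal ((h₂ ^ 2 + 3 * h₁ * h₂) * σ ^ 2) := by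
  set c := h₁ * h₂ - h₂ ^ 2 - h₂ * ρ with hcdef
  set a := F (z - h₁ • F z) - F z with ha
  obtain ⟨hi, h0⟩ := integral_inner_sub_mean hG hmean z a
  have hv := integrable_norm_sub_mean_sq (F := F) hG z
  set Y : A → ℝ := fun v => (‖z - zs‖ ^ 2 + h₂ ^ 2 * σ ^ 2) + h₁ * h₂ *
    (3 * ‖G v z - F z‖ ^ 2 - 2 * inner ℝ a (G v z - F z)) with hY
  have hpt : ∀ v, ‖z - zs - h₂ • F (z - h₁ • G v z)‖ ^ 2 + h₂ ^ 2 * σ ^ 2 +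
      c * ‖F (z - h₁ • G v z)‖ ^ 2 ≤ Y v := by
    intro v
    have hk := norm_sq_sub_two_mul_inner_le hF hh₁ hL z (G v z)
    have hm := hzs (z - h₁ • G v z)
    set p := F (z - h₁ • G v z)
    have e1 : inner ℝ p (z - h₁ • G v z - zs) = inner ℝ p (z - zs) - h₁ * inner ℝ p (G v z) := by
      rw [← real_inner_smul_right, ← inner_sub_right]
      congr 1
      abel
    have e2 : ‖z - zs - h₂ • p‖ ^ 2 =
        ‖z - zs‖ ^ 2 - 2 * h₂ * inner ℝ p (z - zs) + h₂ ^ 2 * ‖p‖ ^ 2 := by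
      rw [norm_sub_sq_real, real_inner_smul_right, norm_smul, mul_pow, Real.norm_eq_abs, sq_abs,
        real_inner_comm]
      ring
    have hk' := mul_le_mul_of_nonneg_left hk (mul_nonneg hh₁ hh₂)
    have hm' := mul_nonneg hh₂ hm
    rw [e1] at hm'
    rw [e2]
    simp only [hY, hcdef]
    linarith
  have hIY : Integrable (fun v => 3 * ‖G v z - F z‖ ^ 2 - 2 * inner ℝ a (G v z - F z)) γ :=
    (hv.const_mul 3).sub (hi.const_mul 2)
  have hYint : Integrable Y γ := (integrable_const _).add (hIY.const_mul _)
  have hYle : ∫ v, Y v ∂γ ≤ ‖z - zs‖ ^ 2 + (h₂ ^ 2 + 3 * h₁ * h₂) * σ ^ 2 := by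
    rw [hY, integral_add (integrable_const _) (hIY.const_mul _), integral_const_mul,
      integral_sub (hv.const_mul 3) (hi.const_mul 2), integral_const_mul, integral_const_mul, h0]
    simp only [integral_const, probReal_univ, one_smul]
    have := mul_le_mul_of_nonneg_left (hvar z) (mul_nonneg hh₁ hh₂)
    linarith
  have hYnn : ∀ v, 0 ≤ Y v := fun v => le_trans (by positivity) (hpt v)
  calc _ ≤ ∫⁻ v, ENNReal.ofReal (‖z - zs - h₂ • F (z - h₁ • G v z)‖ ^ 2 + h₂ ^ 2 * σ ^ 2) ∂γ +
        ∫⁻ v, ENNReal.ofReal c * ENNReal.ofReal (‖F (z - h₁ • G v z)‖ ^ 2) ∂γ := by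
        refine add_le_add (lintegral_mono fun v => ?_) (lintegral_const_mul_le _ _)
        have := lintegral_norm_sub_smul_sq_le hG hmean hvar h₂ (z - zs) (z - h₁ • G v z)
        simpa only [sub_right_comm] using this
    _ = ∫⁻ v, ENNReal.ofReal (‖z - zs - h₂ • F (z - h₁ • G v z)‖ ^ 2 + h₂ ^ 2 * σ ^ 2 +
          c * ‖F (z - h₁ • G v z)‖ ^ 2) ∂γ := by
        rw [← lintegral_add_right]
        · refine lintegral_congr fun v => ?_
          rw [← ENNReal.ofReal_mul hc, ← ENNReal.ofReal_add (by positivity) (by positivity)]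
        · have := hGm z
          fun_prop
    _ ≤ ∫⁻ v, ENNReal.ofReal (Y v) ∂γ :=
        lintegral_mono fun v => ENNReal.ofReal_le_ofReal (hpt v)
    _ = ENNReal.ofReal (∫ v, Y v ∂γ) :=
        (ofReal_integral_eq_lintegral_ofReal hYint (ae_of_all _ hYnn)).symm
    _ ≤ _ := by
        rw [← ENNReal.ofReal_add (by positivity) (by positivity)]
        exact ENNReal.ofReal_le_ofReal hYle

end OneStep

/-! ### The random oracle -/

section Oracle

variable {n m : ℕ} {f : ZOEG.Z n m → ℝ} {K : NNReal}

/-- The map `(a, b) ↦ (a, -b)` as a linear isometry. -/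
noncomputable def flipYIsometry (n m : ℕ) : ZOEG.Z n m →ₗᵢ[ℝ] ZOEG.Z n m where
  toFun := ZOEG.flipY
  map_add' v w := by
    ext (i | j) <;> simp [ZOEG.flipY]
    ring
  map_smul' c v := by
    ext (i | j) <;> simp [ZOEG.flipY]
  norm_map' v := by
    simp [EuclideanSpace.norm_eq, ZOEG.flipY, Fintype.sum_sum_type]

lemma flipYIsometry_apply (v : ZOEG.Z n m) : flipYIsometry n m v = ZOEG.flipY v := rfl

lemma norm_flipY (v : ZOEG.Z n m) : ‖ZOEG.flipY v‖ = ‖v‖ := (flipYIsometry n m).norm_map v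

lemma continuous_flipY : Continuous (ZOEG.flipY : ZOEG.Z n m → ZOEG.Z n m) :=
  (flipYIsometry n m).continuous

lemma norm_smoothOp (μ : ℝ) (z : ZOEG.Z n m) :
    ‖ZOEG.smoothOp f μ z‖ = ‖gradient (ZOEG.smooth f μ) z‖ := norm_flipY _

lemma norm_smoothOp_sub (μ : ℝ) (x y : ZOEG.Z n m) :
    ‖ZOEG.smoothOp f μ x - ZOEG.smoothOp f μ y‖ =
      ‖gradient (ZOEG.smooth f μ) x - gradient (ZOEG.smooth f μ) y‖ := by
  simp only [ZOEG.smoothOp, ← flipYIsometry_apply, ← map_sub, LinearIsometry.norm_map]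

lemma continuous_oracle (hf : Continuous f) (μ : ℝ) :
    Continuous fun p : ZOEG.Z n m × ZOEG.Z n m => ZOEG.oracle f μ p.1 p.2 := by
  unfold ZOEG.oracle
  have := continuous_flipY (n := n) (m := m)
  fun_prop

lemma norm_oracle_le (hf : LipschitzWith K f) {μ : ℝ} (hμ : 0 < μ) (u z : ZOEG.Z n m) :
    ‖ZOEG.oracle f μ u z‖ ≤ K * ‖u‖ ^ 2 := by
  rw [ZOEG.oracle, norm_smul, norm_flipY, norm_div, Real.norm_of_nonneg hμ.le]
  have h := hf.norm_sub_le (z + μ • u) z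
  rw [add_sub_cancel_left, norm_smul, Real.norm_of_nonneg hμ.le] at h
  calc _ ≤ K * (μ * ‖u‖) / μ * ‖u‖ := by gcongr
    _ = _ := by field_simp

lemma memLp_oracle (hf : LipschitzWith K f) {μ : ℝ} (hμ : 0 < μ) (z : ZOEG.Z n m) :
    MemLp (fun u => ZOEG.oracle f μ u z) 2 (stdGaussian (ZOEG.Z n m)) := by
  have hcont : Continuous fun u => ZOEG.oracle f μ u z :=
    (continuous_oracle hf.continuous μ).comp (by fun_prop : Continuous fun u => (u, z))
  rw [memLp_two_iff_integrable_sq_norm hcont.aestronglyMeasurable]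
  refine ((integrable_norm_pow_stdGaussian 4).const_mul ((K : ℝ) ^ 2)).mono'
    (hcont.norm.pow 2).aestronglyMeasurable (ae_of_all _ fun u => ?_)
  rw [Real.norm_of_nonneg (sq_nonneg _)]
  calc ‖ZOEG.oracle f μ u z‖ ^ 2 ≤ (K * ‖u‖ ^ 2) ^ 2 := by
        gcongr; exact norm_oracle_le hf hμ u z
    _ = _ := by ring

/-- The oracle is an unbiased estimate of `F_μ`: the term with `f z` averages out, and the other one
is given by Stein's identity. -/
lemma integral_oracle (hf : LipschitzWith K f) {μ : ℝ} (hμ : 0 < μ) (z : ZOEG.Z n m) :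
    ∫ u, ZOEG.oracle f μ u z ∂(stdGaussian (ZOEG.Z n m)) = ZOEG.smoothOp f μ z := by
  have h1 := integrable_smul_stdGaussian hf hμ.le z
  have h2 : Integrable (fun u : ZOEG.Z n m => f z • u) (stdGaussian (ZOEG.Z n m)) :=
    integrable_id_stdGaussian.fun_smul _
  have h3 : ∀ u, ZOEG.oracle f μ u z =
      flipYIsometry n m (μ⁻¹ • (f (z + μ • u) • u - f z • u)) := by
    intro u
    rw [← sub_smul, smul_smul, map_smul, flipYIsometry_apply, ZOEG.oracle, div_eq_inv_mul]
  simp_rw [h3]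
  have h4 := (flipYIsometry n m).toContinuousLinearMap.integral_comp_comm
    ((h1.sub h2).smul μ⁻¹)
  simp only [LinearIsometry.coe_toContinuousLinearMap, Pi.smul_apply, Pi.sub_apply] at h4
  rw [h4, integral_smul, integral_sub h1 h2, integral_smul, integral_id_stdGaussian,
    integral_smul_stdGaussian hf hμ, smul_zero, sub_zero, smul_smul, inv_mul_cancel₀ hμ.ne',
    one_smul]
  rfl

end Oracle

/-! ### Independence of the iterates and the sampled directions -/

section Iterates

variable {n m : ℕ} {f : ZOEG.Z n m → ℝ} {μ : ℝ} {h₁ h₂ : ℕ → ℝ} {z₀ : ZOEG.Z n m}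

lemma continuous_extrapolate (hf : Continuous f) (μ h : ℝ) :
    Continuous fun p : ZOEG.Z n m × ZOEG.Z n m => ZOEG.extrapolate f μ h p.1 p.2 := by
  have := continuous_oracle hf μ
  unfold ZOEG.extrapolate
  fun_prop

lemma continuous_iterate (hf : Continuous f) (k : ℕ) :
    Continuous fun p : (ℕ → ZOEG.Z n m) × (ℕ → ZOEG.Z n m) =>
      ZOEG.iterate f μ h₁ h₂ z₀ p.1 p.2 k := by
  induction k with
  | zero => exact continuous_const
  | succ k ih =>
    simp only [ZOEG.iterate]
    have he := (continuous_extrapolate hf μ (h₁ k)).comp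
      ((by fun_prop : Continuous fun p : (ℕ → ZOEG.Z n m) × (ℕ → ZOEG.Z n m) => p.1 k).prodMk ih)
    have ho := (continuous_oracle hf μ).comp
      ((by fun_prop : Continuous fun p : (ℕ → ZOEG.Z n m) × (ℕ → ZOEG.Z n m) => p.2 k).prodMk he)
    exact ih.sub (ho.fun_const_smul _)

lemma iterate_congr {a a' b b' : ℕ → ZOEG.Z n m} {k : ℕ} (ha : ∀ i < k, a i = a' i)
    (hb : ∀ i < k, b i = b' i) :
    ZOEG.iterate f μ h₁ h₂ z₀ a b k = ZOEG.iterate f μ h₁ h₂ z₀ a' b' k := by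
  induction k with
  | zero => rfl
  | succ k ih =>
    rw [ZOEG.iterate, ZOEG.iterate, ih (fun i hi => ha i (by omega)) (fun i hi => hb i (by omega)),
      ha k (by omega), hb k (by omega)]

variable {Ω : Type*} [MeasurableSpace Ω] {P : Measure Ω} {uhat u : ℕ → Ω → ZOEG.Z n m}

lemma aemeasurable_iterate (hf : Continuous f) (huhat : ∀ k, AEMeasurable (uhat k) P)
    (hu : ∀ k, AEMeasurable (u k) P) (k : ℕ) :
    AEMeasurable (fun ω => ZOEG.iterate f μ h₁ h₂ z₀ (fun i => uhat i ω) (fun i => u i ω) k) P :=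
  (continuous_iterate hf k).measurable.comp_aemeasurable
    ((aemeasurable_pi_lambda _ huhat).prodMk (aemeasurable_pi_lambda _ hu))

/-- The iterate `z_k` is a function of the directions of the steps before `k`. -/
lemma indepFun_iterate (hf : Continuous f) (huhat : ∀ k, AEMeasurable (uhat k) P)
    (hu : ∀ k, AEMeasurable (u k) P)
    (hindep : iIndepFun (Sum.elim uhat u : ℕ ⊕ ℕ → Ω → ZOEG.Z n m) P) (k : ℕ) :
    IndepFun (fun ω => ZOEG.iterate f μ h₁ h₂ z₀ (fun i => uhat i ω) (fun i => u i ω) k)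
      (fun ω => (uhat k ω, u k ω)) P := by
  set S : Finset (ℕ ⊕ ℕ) := (Finset.range k).disjSum (Finset.range k) with hS
  set T : Finset (ℕ ⊕ ℕ) := {Sum.inl k, Sum.inr k} with hT
  have hST : Disjoint S T := by
    rw [Finset.disjoint_left]
    rintro (i | i) hi hi' <;> simp [hS, hT] at hi hi' <;> omega
  have hmeas : ∀ i, AEMeasurable ((Sum.elim uhat u : ℕ ⊕ ℕ → Ω → ZOEG.Z n m) i) P := by
    rintro (i | i)
    exacts [huhat i, hu i]
  have hind := hindep.indepFun_finset₀ S T hST hmeas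
  -- the directions outside `S` are replaced by `0`, as `z_k` does not depend on them
  let φ : (S → ZOEG.Z n m) → (ℕ → ZOEG.Z n m) × (ℕ → ZOEG.Z n m) := fun x =>
    (fun i => if h : Sum.inl i ∈ S then x ⟨Sum.inl i, h⟩ else 0,
      fun i => if h : Sum.inr i ∈ S then x ⟨Sum.inr i, h⟩ else 0)
  have hφ : Measurable φ := by
    refine Measurable.prodMk (measurable_pi_lambda _ fun i => ?_)
      (measurable_pi_lambda _ fun i => ?_)
    · by_cases h : Sum.inl i ∈ S
      · simpa only [h, dite_true] using measurable_pi_apply _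
      · simpa only [h, dite_false] using measurable_const
    · by_cases h : Sum.inr i ∈ S
      · simpa only [h, dite_true] using measurable_pi_apply _
      · simpa only [h, dite_false] using measurable_const
  let ψ : (T → ZOEG.Z n m) → ZOEG.Z n m × ZOEG.Z n m := fun y =>
    (y ⟨Sum.inl k, by simp [hT]⟩, y ⟨Sum.inr k, by simp [hT]⟩)
  have hψ : Measurable ψ := (measurable_pi_apply _).prodMk (measurable_pi_apply _)
  have h := hind.comp ((continuous_iterate (μ := μ) (h₁ := h₁) (h₂ := h₂) (z₀ := z₀) hf
    k).measurable.comp hφ) hψ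
  convert h using 1
  swap
  · rfl
  ext1 ω
  refine iterate_congr (fun i hi => ?_) (fun i hi => ?_) <;> simp [φ, hS, hi]

/-- Integration over the directions of step `k`, which are independent of each other and of `z_k`,
with `z_k` fixed. -/
lemma lintegral_iterate [IsProbabilityMeasure P] (hf : Continuous f)
    (huhat : ∀ k, HasLaw (uhat k) (stdGaussian (ZOEG.Z n m)) P)
    (hu : ∀ k, HasLaw (u k) (stdGaussian (ZOEG.Z n m)) P)
    (hindep : iIndepFun (Sum.elim uhat u : ℕ ⊕ ℕ → Ω → ZOEG.Z n m) P) (k : ℕ)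
    {H : ZOEG.Z n m → ZOEG.Z n m → ZOEG.Z n m → ENNReal}
    (hH : Measurable fun p : ZOEG.Z n m × ZOEG.Z n m × ZOEG.Z n m => H p.1 p.2.1 p.2.2) :
    ∫⁻ ω, H (ZOEG.iterate f μ h₁ h₂ z₀ (fun i => uhat i ω) (fun i => u i ω) k)
        (uhat k ω) (u k ω) ∂P =
      ∫⁻ ω, ∫⁻ v, ∫⁻ w, H (ZOEG.iterate f μ h₁ h₂ z₀ (fun i => uhat i ω) (fun i => u i ω) k)
        v w ∂(stdGaussian (ZOEG.Z n m)) ∂(stdGaussian (ZOEG.Z n m)) ∂P := by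
  set γ := stdGaussian (ZOEG.Z n m)
  set Z := fun ω => ZOEG.iterate f μ h₁ h₂ z₀ (fun i => uhat i ω) (fun i => u i ω) k
  have hm1 := fun k => (huhat k).aemeasurable
  have hm2 := fun k => (hu k).aemeasurable
  have hZ : AEMeasurable Z P := aemeasurable_iterate hf hm1 hm2 k
  have hpair : AEMeasurable (fun ω => (uhat k ω, u k ω)) P := (hm1 k).prodMk (hm2 k)
  have hlaw : P.map (fun ω => (uhat k ω, u k ω)) = γ.prod γ := by
    have h : IndepFun (uhat k) (u k) P :=
      hindep.indepFun (i := Sum.inl k) (j := Sum.inr k) (by simp)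
    rw [(indepFun_iff_map_prod_eq_prod_map_map (hm1 k) (hm2 k)).1 h, (huhat k).map_eq,
      (hu k).map_eq]
  have hjoint : P.map (fun ω => (Z ω, (uhat k ω, u k ω))) = (P.map Z).prod (γ.prod γ) := by
    rw [(indepFun_iff_map_prod_eq_prod_map_map hZ hpair).1 (indepFun_iterate hf hm1 hm2 hindep k),
      hlaw]
  have : IsProbabilityMeasure (P.map Z) := Measure.isProbabilityMeasure_map hZ
  calc ∫⁻ ω, H (Z ω) (uhat k ω) (u k ω) ∂P
      = ∫⁻ p, H p.1 p.2.1 p.2.2 ∂(P.map fun ω => (Z ω, (uhat k ω, u k ω))) :=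
        (lintegral_map' hH.aemeasurable (hZ.prodMk hpair)).symm
    _ = ∫⁻ z, ∫⁻ q, H z q.1 q.2 ∂(γ.prod γ) ∂(P.map Z) := by
        rw [hjoint, lintegral_prod _ hH.aemeasurable]
    _ = ∫⁻ z, ∫⁻ v, ∫⁻ w, H z v w ∂γ ∂γ ∂(P.map Z) := by
        refine lintegral_congr fun z => ?_
        exact lintegral_prod _ (hH.comp (measurable_const.prodMk measurable_id)).aemeasurable
    _ = _ := by
        refine lintegral_map' (Measurable.aemeasurable ?_) hZ
        refine Measurable.lintegral_prod_right' (f := fun p : ZOEG.Z n m × ZOEG.Z n m =>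
          ∫⁻ w, H p.1 p.2 w ∂γ) ?_
        exact Measurable.lintegral_prod_right' (f := fun p : (ZOEG.Z n m × ZOEG.Z n m) × ZOEG.Z n m =>
          H p.1.1 p.1.2 p.2) (hH.comp (by fun_prop : Measurable fun p :
            (ZOEG.Z n m × ZOEG.Z n m) × ZOEG.Z n m => (p.1.1, p.1.2, p.2)))

lemma lintegral_iterate_extrapolation [IsProbabilityMeasure P] (hf : Continuous f)
    (huhat : ∀ k, HasLaw (uhat k) (stdGaussian (ZOEG.Z n m)) P)
    (hu : ∀ k, HasLaw (u k) (stdGaussian (ZOEG.Z n m)) P)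
    (hindep : iIndepFun (Sum.elim uhat u : ℕ ⊕ ℕ → Ω → ZOEG.Z n m) P) (k : ℕ)
    {H : ZOEG.Z n m → ZOEG.Z n m → ENNReal}
    (hH : Measurable fun p : ZOEG.Z n m × ZOEG.Z n m => H p.1 p.2) :
    ∫⁻ ω, H (ZOEG.iterate f μ h₁ h₂ z₀ (fun i => uhat i ω) (fun i => u i ω) k) (uhat k ω) ∂P =
      ∫⁻ ω, ∫⁻ v, H (ZOEG.iterate f μ h₁ h₂ z₀ (fun i => uhat i ω) (fun i => u i ω) k) v
        ∂(stdGaussian (ZOEG.Z n m)) ∂P := by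
  have hm : Measurable fun p : ZOEG.Z n m × ZOEG.Z n m × ZOEG.Z n m => H p.1 p.2.1 :=
    hH.comp (measurable_fst.prodMk measurable_snd.fst)
  have h := lintegral_iterate (μ := μ) (h₁ := h₁) (h₂ := h₂) (z₀ := z₀)
    (H := fun z v _ => H z v) hf huhat hu hindep k hm
  simpa only [lintegral_const, measure_univ, mul_one] using h

end Iterates

/-! ### Convergence of the method -/

section Convergence

variable {n m : ℕ} {f : ZOEG.Z n m → ℝ} {K : NNReal} {μ : ℝ}
  {Ω : Type*} [MeasurableSpace Ω] {P : Measure Ω} [IsProbabilityMeasure P]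
  {uhat u : ℕ → Ω → ZOEG.Z n m}

/-- The inequality `extragradient_step` integrated over the law of `z_k`. -/
lemma lintegral_iterate_succ_le (hf : LipschitzWith K f) (hμ : 0 < μ)
    (huhat : ∀ k, HasLaw (uhat k) (stdGaussian (ZOEG.Z n m)) P)
    (hu : ∀ k, HasLaw (u k) (stdGaussian (ZOEG.Z n m)) P)
    (hindep : iIndepFun (Sum.elim uhat u : ℕ ⊕ ℕ → Ω → ZOEG.Z n m) P)
    {L σ ρ : ℝ} {zs : ZOEG.Z n m}
    (hL : ∀ x y, ‖ZOEG.smoothOp f μ x - ZOEG.smoothOp f μ y‖ ≤ L * ‖x - y‖)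
    (hvar : ∀ z, ∫ v, ‖ZOEG.oracle f μ v z - ZOEG.smoothOp f μ z‖ ^ 2
      ∂(stdGaussian (ZOEG.Z n m)) ≤ σ ^ 2)
    (hzs : ZOEG.IsWeakMinty (ZOEG.smoothOp f μ) ρ zs) (z₀ : ZOEG.Z n m)
    {h₁ h₂ : ℝ} (hh₁ : 0 ≤ h₁) (hh₂ : 0 ≤ h₂) (hLh : L * h₁ ≤ 1)
    (hc : 0 < h₁ * h₂ - h₂ ^ 2 - h₂ * ρ) (k : ℕ) :
    ∫⁻ ω, ENNReal.ofReal (‖ZOEG.iterate f μ (fun _ => h₁) (fun _ => h₂) z₀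
        (fun i => uhat i ω) (fun i => u i ω) (k + 1) - zs‖ ^ 2) ∂P +
      ENNReal.ofReal (h₁ * h₂ - h₂ ^ 2 - h₂ * ρ) *
        ∫⁻ ω, ENNReal.ofReal (‖ZOEG.smoothOp f μ (ZOEG.iterateHat f μ (fun _ => h₁)
          (fun _ => h₂) z₀ (fun i => uhat i ω) (fun i => u i ω) k)‖ ^ 2) ∂P ≤
      ∫⁻ ω, ENNReal.ofReal (‖ZOEG.iterate f μ (fun _ => h₁) (fun _ => h₂) z₀
        (fun i => uhat i ω) (fun i => u i ω) k - zs‖ ^ 2) ∂P +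
      ENNReal.ofReal ((h₂ ^ 2 + 3 * h₁ * h₂) * σ ^ 2) := by
  set γ := stdGaussian (ZOEG.Z n m)
  set F := ZOEG.smoothOp f μ
  simp only [ZOEG.iterateHat]
  set Z : Ω → ZOEG.Z n m := fun ω => ZOEG.iterate f μ (fun _ => h₁) (fun _ => h₂) z₀
    (fun i => uhat i ω) (fun i => u i ω) k with hZ
  set c := h₁ * h₂ - h₂ ^ 2 - h₂ * ρ
  set C := (h₂ ^ 2 + 3 * h₁ * h₂) * σ ^ 2
  have hLip : LipschitzWith L.toNNReal F := LipschitzWith.of_dist_le_mul fun x y => by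
    rw [dist_eq_norm, dist_eq_norm]
    exact (hL x y).trans (by gcongr; exact Real.le_coe_toNNReal L)
  have hFc : Continuous F := hLip.continuous
  have hfc := hf.continuous
  have hoc := continuous_oracle hfc μ
  have hec := continuous_extrapolate hfc μ h₁
  have hZm : AEMeasurable Z P :=
    aemeasurable_iterate hfc (fun k => (huhat k).aemeasurable) (fun k => (hu k).aemeasurable) k
  have ha1 : ∫⁻ ω, ENNReal.ofReal (‖ZOEG.iterate f μ (fun _ => h₁) (fun _ => h₂) z₀
      (fun i => uhat i ω) (fun i => u i ω) (k + 1) - zs‖ ^ 2) ∂P =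
      ∫⁻ ω, ∫⁻ v, ∫⁻ w, ENNReal.ofReal (‖Z ω - h₂ • ZOEG.oracle f μ w
        (ZOEG.extrapolate f μ h₁ v (Z ω)) - zs‖ ^ 2) ∂γ ∂γ ∂P := by
    refine lintegral_iterate (H := fun z v w => ENNReal.ofReal (‖z - h₂ • ZOEG.oracle f μ w
      (ZOEG.extrapolate f μ h₁ v z) - zs‖ ^ 2)) hfc huhat hu hindep k ?_
    have h1 : Continuous fun p : ZOEG.Z n m × ZOEG.Z n m × ZOEG.Z n m =>
        ZOEG.extrapolate f μ h₁ p.2.1 p.1 :=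
      hec.comp (by fun_prop : Continuous fun p : ZOEG.Z n m × ZOEG.Z n m × ZOEG.Z n m =>
        (p.2.1, p.1))
    have h2 : Continuous fun p : ZOEG.Z n m × ZOEG.Z n m × ZOEG.Z n m =>
        ZOEG.oracle f μ p.2.2 (ZOEG.extrapolate f μ h₁ p.2.1 p.1) :=
      hoc.comp ((by fun_prop : Continuous fun p : ZOEG.Z n m × ZOEG.Z n m × ZOEG.Z n m =>
        p.2.2).prodMk h1)
    exact (by fun_prop : Continuous fun p : ZOEG.Z n m × ZOEG.Z n m × ZOEG.Z n m =>
      ‖p.1 - h₂ • ZOEG.oracle f μ p.2.2 (ZOEG.extrapolate f μ h₁ p.2.1 p.1) - zs‖ ^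
        2).measurable.ennreal_ofReal
  have hB : Measurable fun p : ZOEG.Z n m × ZOEG.Z n m =>
      ENNReal.ofReal (‖F (ZOEG.extrapolate f μ h₁ p.2 p.1)‖ ^ 2) :=
    ((hFc.comp (hec.comp continuous_swap)).norm.pow 2).measurable.ennreal_ofReal
  have hb1 : ∫⁻ ω, ENNReal.ofReal (‖F (ZOEG.extrapolate f μ h₁ (uhat k ω) (Z ω))‖ ^ 2) ∂P =
      ∫⁻ ω, ∫⁻ v, ENNReal.ofReal (‖F (ZOEG.extrapolate f μ h₁ v (Z ω))‖ ^ 2) ∂γ ∂P :=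
    lintegral_iterate_extrapolation
    (H := fun z v => ENNReal.ofReal (‖F (ZOEG.extrapolate f μ h₁ v z)‖ ^ 2))
    hfc huhat hu hindep k hB
  have hBm : AEMeasurable (fun ω => ENNReal.ofReal c *
      ∫⁻ v, ENNReal.ofReal (‖F (ZOEG.extrapolate f μ h₁ v (Z ω))‖ ^ 2) ∂γ) P :=
    (hB.lintegral_prod_right'.comp_aemeasurable hZm).const_mul _
  rw [ha1, hb1, ← lintegral_const_mul' _ _ ENNReal.ofReal_ne_top, ← lintegral_add_right' _ hBm]
  calc _ ≤ ∫⁻ ω, (ENNReal.ofReal (‖Z ω - zs‖ ^ 2) + ENNReal.ofReal C) ∂P := by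
        refine lintegral_mono fun ω => ?_
        exact extragradient_step (G := ZOEG.oracle f μ) hL hFc.measurable
          (fun z => (hoc.comp (by fun_prop : Continuous fun v => (v, z))).measurable)
          (memLp_oracle hf hμ) (integral_oracle hf hμ) hvar hzs hh₁ hh₂ hLh hc.le (Z ω)
    _ = _ := by
        rw [lintegral_add_right _ measurable_const]
        simp [hZ]

/-- The step inequality summed over the iterations: some iterate is at most as bad as the
average. -/
theorem exists_lintegral_smoothOp_sq_le (hf : LipschitzWith K f) (hμ : 0 < μ)
    (huhat : ∀ k, HasLaw (uhat k) (stdGaussian (ZOEG.Z n m)) P)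
    (hu : ∀ k, HasLaw (u k) (stdGaussian (ZOEG.Z n m)) P)
    (hindep : iIndepFun (Sum.elim uhat u : ℕ ⊕ ℕ → Ω → ZOEG.Z n m) P)
    {L σ ρ : ℝ} {zs : ZOEG.Z n m}
    (hL : ∀ x y, ‖ZOEG.smoothOp f μ x - ZOEG.smoothOp f μ y‖ ≤ L * ‖x - y‖)
    (hvar : ∀ z, ∫ v, ‖ZOEG.oracle f μ v z - ZOEG.smoothOp f μ z‖ ^ 2
      ∂(stdGaussian (ZOEG.Z n m)) ≤ σ ^ 2)
    (hzs : ZOEG.IsWeakMinty (ZOEG.smoothOp f μ) ρ zs) (z₀ : ZOEG.Z n m)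
    {h₁ h₂ : ℝ} (hh₁ : 0 ≤ h₁) (hh₂ : 0 ≤ h₂) (hLh : L * h₁ ≤ 1)
    (hc : 0 < h₁ * h₂ - h₂ ^ 2 - h₂ * ρ) (N : ℕ) :
    ∃ k ≤ N, ∫⁻ ω, ENNReal.ofReal (‖ZOEG.smoothOp f μ (ZOEG.iterateHat f μ (fun _ => h₁)
        (fun _ => h₂) z₀ (fun i => uhat i ω) (fun i => u i ω) k)‖ ^ 2) ∂P ≤
      ENNReal.ofReal ((‖z₀ - zs‖ ^ 2 + (N + 1) * ((h₂ ^ 2 + 3 * h₁ * h₂) * σ ^ 2)) /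
        ((N + 1) * (h₁ * h₂ - h₂ ^ 2 - h₂ * ρ))) := by
  set c := h₁ * h₂ - h₂ ^ 2 - h₂ * ρ
  set C := (h₂ ^ 2 + 3 * h₁ * h₂) * σ ^ 2
  have hC0 : 0 ≤ C := by positivity
  set Z : ℕ → Ω → ZOEG.Z n m := fun k ω => ZOEG.iterate f μ (fun _ => h₁) (fun _ => h₂) z₀
    (fun i => uhat i ω) (fun i => u i ω) k with hZ
  set a : ℕ → ENNReal := fun k => ∫⁻ ω, ENNReal.ofReal (‖Z k ω - zs‖ ^ 2) ∂P with ha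
  set b : ℕ → ENNReal := fun k => ∫⁻ ω, ENNReal.ofReal (‖ZOEG.smoothOp f μ (ZOEG.iterateHat f μ
    (fun _ => h₁) (fun _ => h₂) z₀ (fun i => uhat i ω) (fun i => u i ω) k)‖ ^ 2) ∂P
  have hstep : ∀ k, a (k + 1) + ENNReal.ofReal c * b k ≤ a k + ENNReal.ofReal C :=
    lintegral_iterate_succ_le hf hμ huhat hu hindep hL hvar hzs z₀ hh₁ hh₂ hLh hc
  have ha0 : a 0 = ENNReal.ofReal (‖z₀ - zs‖ ^ 2) := by simp [ha, hZ, ZOEG.iterate]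
  have hsum : ∀ M : ℕ, a M + ∑ k ∈ Finset.range M, ENNReal.ofReal c * b k ≤
      a 0 + M * ENNReal.ofReal C := by
    intro M
    induction M with
    | zero => simp
    | succ M ih =>
      rw [Finset.sum_range_succ]
      calc _ = (a (M + 1) + ENNReal.ofReal c * b M) +
            ∑ k ∈ Finset.range M, ENNReal.ofReal c * b k := by ring
        _ ≤ (a M + ENNReal.ofReal C) + ∑ k ∈ Finset.range M, ENNReal.ofReal c * b k := by
            gcongr ?_ + _; exact hstep M
        _ = (a M + ∑ k ∈ Finset.range M, ENNReal.ofReal c * b k) + ENNReal.ofReal C := by ring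
        _ ≤ (a 0 + M * ENNReal.ofReal C) + ENNReal.ofReal C := by gcongr
        _ = _ := by push_cast; ring
  obtain ⟨k, hk, hmin⟩ := Finset.exists_min_image (Finset.range (N + 1))
    (fun k => ENNReal.ofReal c * b k) ⟨0, by simp⟩
  refine ⟨k, by simpa [Nat.lt_succ_iff] using hk, ?_⟩
  have hcard := Finset.card_nsmul_le_sum (Finset.range (N + 1)) (fun k => ENNReal.ofReal c * b k)
    (ENNReal.ofReal c * b k) hmin
  rw [Finset.card_range, nsmul_eq_mul] at hcard
  have hfin := hcard.trans (le_add_self.trans (hsum (N + 1)))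
  have hN : (0 : ℝ) < N + 1 := by positivity
  have hcast : ((N + 1 : ℕ) : ENNReal) = ENNReal.ofReal (N + 1) := by
    rw [← ENNReal.ofReal_natCast]; push_cast; rfl
  rw [ha0, hcast, ← mul_assoc, ← ENNReal.ofReal_mul hN.le, ← ENNReal.ofReal_mul hN.le,
    ← ENNReal.ofReal_add (by positivity) (by positivity)] at hfin
  rw [ENNReal.ofReal_div_of_pos (by positivity), ENNReal.le_div_iff_mul_le
    (Or.inl (by simpa using by positivity)) (Or.inl ENNReal.ofReal_ne_top), mul_comm]
  exact hfin

/-- The inequalities behind the constants of the convergence bound. They rest on `L h₁ ≤ 1`,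
`L h₂ ≤ 1 / 2` and `h₂ ≤ h₁ - h₂`. -/
lemma stepsize_bounds {L ρ h₁ h₂ : ℝ} (hL : 0 < L) (hρ : 0 ≤ ρ) (hh₁ : h₁ ≤ 1 / L)
    (hh₂ : √(ρ / L) < h₂) (hh : h₂ ≤ h₁ / 2) :
    0 < h₂ ∧ 0 < L * h₂ ^ 2 - ρ ∧
      L * h₂ ^ 2 - ρ ≤ 2 * L * (h₁ * h₂ - h₂ ^ 2 - h₂ * ρ) ∧
      L * (L * h₂ ^ 2 - ρ) * (h₂ ^ 2 + 3 * h₁ * h₂) ≤ 3 * (h₁ * h₂ - h₂ ^ 2 - h₂ * ρ) := by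
  have hpos : 0 < h₂ := (Real.sqrt_nonneg _).trans_lt hh₂
  have hD : ρ < L * h₂ ^ 2 := by
    rw [Real.sqrt_lt (by positivity) hpos.le, div_lt_iff₀ hL] at hh₂
    linarith
  have hL1 : L * h₁ ≤ 1 := by
    rw [le_div_iff₀ hL] at hh₁; linarith
  have hL2 : L * h₂ ≤ 1 / 2 := by nlinarith
  have hgap : h₂ - ρ ≤ h₁ - h₂ - ρ := by linarith
  have hLρ : L * (L * h₂ ^ 2 - ρ) * (h₂ + 3 * h₁) ≤ 7 / 2 * (L * h₂ ^ 2 - ρ) := by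
    have : L * (h₂ + 3 * h₁) ≤ 7 / 2 := by linarith
    nlinarith
  have hLh : L * h₂ ^ 2 ≤ h₂ / 2 := by nlinarith
  refine ⟨hpos, by linarith, ?_, ?_⟩
  · have h1 : 2 * (L * h₂) * (h₂ - ρ) ≤ 2 * (L * h₂) * (h₁ - h₂ - ρ) := by gcongr
    have h2 : 2 * (L * h₂) * ρ ≤ 1 * ρ := by gcongr; linarith
    nlinarith [mul_pos hL (pow_pos hpos 2)]
  · have h1 : L * (L * h₂ ^ 2 - ρ) * (h₂ + 3 * h₁) ≤ 3 * (h₁ - h₂ - ρ) := by linarith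
    nlinarith [mul_le_mul_of_nonneg_left h1 hpos.le]

/-- With at least the prescribed number of iterations, the initial distance contributes at most
`ε² / 4` to the average and the noise at most `3 σ² / (L (L h₂² - ρ))`. -/
lemma average_bound_le_sq {L ρ h₁ h₂ σ ε r : ℝ} {N : ℕ} (hL : 0 < L) (hρ : 0 ≤ ρ)
    (hh₁ : h₁ ≤ 1 / L) (hh₂ : √(ρ / L) < h₂) (hh : h₂ ≤ h₁ / 2) (hσ : 0 ≤ σ) (hε : 0 < ε)
    (hN : ⌈8 * r ^ 2 * L / (L * h₂ ^ 2 - ρ) * (ε ^ 2)⁻¹ - 1⌉ ≤ (N : ℤ)) :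
    (r ^ 2 + (N + 1) * ((h₂ ^ 2 + 3 * h₁ * h₂) * σ ^ 2)) /
        ((N + 1) * (h₁ * h₂ - h₂ ^ 2 - h₂ * ρ)) ≤
      (ε / 2 + √(3 / (L * (L * h₂ ^ 2 - ρ))) * σ) ^ 2 := by
  obtain ⟨-, hD, hc1, hc2⟩ := stepsize_bounds hL hρ hh₁ hh₂ hh
  set D := L * h₂ ^ 2 - ρ
  set c := h₁ * h₂ - h₂ ^ 2 - h₂ * ρ
  have hc : 0 < c := by
    by_contra h
    nlinarith
  have hN1 : (0 : ℝ) < N + 1 := by positivity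
  have hN' : 8 * r ^ 2 * L ≤ (N + 1) * (D * ε ^ 2) := by
    have h := Int.ceil_le.1 hN
    rw [← div_eq_mul_inv, div_div, sub_le_iff_le_add, div_le_iff₀ (by positivity)] at h
    simpa using h
  have h1 : r ^ 2 ≤ (N + 1) * c * (ε ^ 2 / 4) := by
    have h2 : (N + 1) * (D * ε ^ 2) ≤ (N + 1) * (2 * L * c * ε ^ 2) := by gcongr
    refine le_of_mul_le_mul_left ?_ hL
    linarith
  have h3 : (h₂ ^ 2 + 3 * h₁ * h₂) * σ ^ 2 ≤ c * (3 / (L * D) * σ ^ 2) := by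
    have h4 : h₂ ^ 2 + 3 * h₁ * h₂ ≤ c * (3 / (L * D)) := by
      rw [mul_div_assoc', le_div_iff₀ (by positivity)]
      linarith
    calc _ ≤ c * (3 / (L * D)) * σ ^ 2 := by gcongr
      _ = _ := by ring
  have hsq : √(3 / (L * D)) ^ 2 = 3 / (L * D) := Real.sq_sqrt (by positivity)
  rw [div_le_iff₀ (by positivity)]
  calc r ^ 2 + (N + 1) * ((h₂ ^ 2 + 3 * h₁ * h₂) * σ ^ 2)
      ≤ (N + 1) * c * (ε ^ 2 / 4) + (N + 1) * (c * (3 / (L * D) * σ ^ 2)) := by gcongr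
    _ = (ε ^ 2 / 4 + √(3 / (L * D)) ^ 2 * σ ^ 2) * ((N + 1) * c) := by rw [hsq]; ring
    _ ≤ (ε / 2 + √(3 / (L * D)) * σ) ^ 2 * ((N + 1) * c) := by
      gcongr
      have : 0 ≤ ε * (√(3 / (L * D)) * σ) := by positivity
      linarith

/-- Jensen's inequality for the square, through `x ≤ (x² / t + t) / 2`. -/
lemma lintegral_ofReal_le_of_sq_le {g : Ω → ℝ} {t : ℝ} (ht : 0 < t)
    (h : ∫⁻ ω, ENNReal.ofReal (g ω ^ 2) ∂P ≤ ENNReal.ofReal (t ^ 2)) :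
    ∫⁻ ω, ENNReal.ofReal (g ω) ∂P ≤ ENNReal.ofReal t := by
  have hpt : ∀ x : ℝ, x ≤ 1 / (2 * t) * x ^ 2 + t / 2 := by
    intro x
    have : 1 / (2 * t) * x ^ 2 + t / 2 - x = (x - t) ^ 2 / (2 * t) := by field_simp; ring
    have : 0 ≤ (x - t) ^ 2 / (2 * t) := by positivity
    linarith
  calc _ ≤ ∫⁻ ω, (ENNReal.ofReal (1 / (2 * t)) * ENNReal.ofReal (g ω ^ 2) +
        ENNReal.ofReal (t / 2)) ∂P := by
        refine lintegral_mono fun ω => ?_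
        rw [← ENNReal.ofReal_mul (by positivity), ← ENNReal.ofReal_add (by positivity)
          (by positivity)]
        exact ENNReal.ofReal_le_ofReal (hpt _)
    _ = ENNReal.ofReal (1 / (2 * t)) * ∫⁻ ω, ENNReal.ofReal (g ω ^ 2) ∂P +
        ENNReal.ofReal (t / 2) := by
        rw [lintegral_add_right _ measurable_const, lintegral_const_mul' _ _ ENNReal.ofReal_ne_top]
        simp
    _ ≤ ENNReal.ofReal (1 / (2 * t)) * ENNReal.ofReal (t ^ 2) + ENNReal.ofReal (t / 2) := by
        gcongr
    _ = ENNReal.ofReal t := by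
        rw [← ENNReal.ofReal_mul (by positivity), ← ENNReal.ofReal_add (by positivity)
          (by positivity)]
        congr 1
        field_simp
        ring

end Convergence


theorem mainTheorem4
    -- the objective: a Lipschitz function on `ℝⁿ × ℝᵐ`, and the smoothing parameter
    (n m : ℕ) (hd : 0 < n + m) (f : ZOEG.Z n m → ℝ)
    (L₀ : ℝ) (hL₀ : 0 < L₀) (hf : ∀ x y, |f x - f y| ≤ L₀ * ‖x - y‖)
    (μ : ℝ) (hμ : 0 < μ)
    -- the randomness: independent standard Gaussian directions
    {Ω : Type*} [MeasurableSpace Ω] (P : Measure Ω) [IsProbabilityMeasure P]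
    (uhat u : ℕ → Ω → ZOEG.Z n m)
    (huhat : ∀ k, HasLaw (uhat k) (stdGaussian (ZOEG.Z n m)) P)
    (hu : ∀ k, HasLaw (u k) (stdGaussian (ZOEG.Z n m)) P)
    (hindep : iIndepFun (Sum.elim uhat u : ℕ ⊕ ℕ → Ω → ZOEG.Z n m) P) :
    -- `f_μ` is differentiable and `√d L₀ / μ` is a Lipschitz constant of its gradient
    (Differentiable ℝ (ZOEG.smooth f μ) ∧
      ∀ x y, ‖gradient (ZOEG.smooth f μ) x - gradient (ZOEG.smooth f μ) y‖ ≤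
        √((n + m : ℕ) : ℝ) * L₀ / μ * ‖x - y‖) ∧
    -- and for every Lipschitz constant `L₁` of that gradient the algorithm converges
    ∀ L₁ : ℝ, 0 < L₁ →
      (∀ x y, ‖gradient (ZOEG.smooth f μ) x - gradient (ZOEG.smooth f μ) y‖ ≤ L₁ * ‖x - y‖) →
    ∀ σ : ℝ, 0 ≤ σ →
      (∀ z, ∫ v, ‖ZOEG.oracle f μ v z - ZOEG.smoothOp f μ z‖ ^ 2 ∂(stdGaussian (ZOEG.Z n m))
        ≤ σ ^ 2) →
    ∀ (ρ : ℝ) (zs : ZOEG.Z n m), 0 ≤ ρ → ρ < 1 / (4 * L₁) →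
      ZOEG.IsWeakMinty (ZOEG.smoothOp f μ) ρ zs →
    ∀ (z₀ : ZOEG.Z n m) (h₁ h₂ : ℝ), h₁ ≤ 1 / L₁ → √(ρ / L₁) < h₂ → h₂ ≤ h₁ / 2 →
    ∀ δ ε : ℝ, 0 < δ → δ < 1 → 0 < ε →
      μ ≤ δ / √(((n + m : ℕ) : ℝ) * Real.pi * Real.exp 1) *
        (ε / (8 * L₀)) ^ (1 / ((n + m : ℕ) : ℝ)) →
    ∀ N : ℕ, ⌈8 * ‖z₀ - zs‖ ^ 2 * L₁ / (L₁ * h₂ ^ 2 - ρ) * (ε ^ 2)⁻¹ - 1⌉ ≤ (N : ℤ) →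
    ∃ k ≤ N,
      ZOEG.IsGoldsteinStationaryInExpectation P f δ
        (ε + √(3 / (L₁ * (L₁ * h₂ ^ 2 - ρ))) * σ)
        (fun ω => ZOEG.iterateHat f μ (fun _ => h₁) (fun _ => h₂) z₀
          (fun i => uhat i ω) (fun i => u i ω) k) := by
  have hLip : LipschitzWith L₀.toNNReal f := LipschitzWith.of_dist_le_mul fun x y => by
    rw [Real.coe_toNNReal _ hL₀.le, Real.dist_eq, dist_eq_norm]
    exact hf x y
  have hfin : Module.finrank ℝ (ZOEG.Z n m) = n + m := by simp
  refine ⟨⟨fun z => (hasGradientAt_integral_stdGaussian hLip hμ z).differentiableAt,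
    fun x y => ?_⟩, ?_⟩
  · have h := norm_gradient_sub_integral_stdGaussian_le hLip hμ x y
    rwa [hfin, Real.coe_toNNReal _ hL₀.le] at h
  intro L₁ hL₁ hL σ hσ hvar ρ zs hρ _ hzs z₀ h₁ h₂ hh₁ hh₂ hh δ ε hδ _ hε hsmall N hN
  obtain ⟨hpos, hD, hc1, -⟩ := stepsize_bounds hL₁ hρ hh₁ hh₂ hh
  have hc : 0 < h₁ * h₂ - h₂ ^ 2 - h₂ * ρ := by
    by_contra h
    nlinarith
  have hLh : L₁ * h₁ ≤ 1 := by
    rw [le_div_iff₀ hL₁] at hh₁; linarith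
  obtain ⟨k, hk, hbound⟩ := exists_lintegral_smoothOp_sq_le hLip hμ huhat hu hindep
    (fun x y => (norm_smoothOp_sub μ x y).trans_le (hL x y)) hvar hzs z₀ (by linarith) hpos.le
    hLh hc N
  refine ⟨k, hk, ?_⟩
  set t := ε / 2 + √(3 / (L₁ * (L₁ * h₂ ^ 2 - ρ))) * σ with ht
  have htpos : 0 < t := by positivity
  have hmean := lintegral_ofReal_le_of_sq_le htpos
    (hbound.trans (ENNReal.ofReal_le_ofReal
      (average_bound_le_sq hL₁ hρ hh₁ hh₂ hh hσ hε hN)))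
  unfold ZOEG.IsGoldsteinStationaryInExpectation
  calc _ ≤ ∫⁻ ω, (ENNReal.ofReal ‖ZOEG.smoothOp f μ (ZOEG.iterateHat f μ (fun _ => h₁)
          (fun _ => h₂) z₀ (fun i => uhat i ω) (fun i => u i ω) k)‖ +
          ENNReal.ofReal (ε / 4)) ∂P := by
        refine lintegral_mono fun ω => ?_
        rw [norm_smoothOp, ← ENNReal.ofReal_add (norm_nonneg _) (by positivity)]
        exact infEDist_goldstein_le_of_smoothing_le hd hL₀ hLip hμ hδ hε hsmall _
    _ ≤ ENNReal.ofReal t + ENNReal.ofReal (ε / 4) := by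
        rw [lintegral_add_right _ measurable_const]
        simpa using add_le_add_left hmean (ENNReal.ofReal (ε / 4))
    _ ≤ _ := by
        rw [← ENNReal.ofReal_add htpos.le (by positivity)]
        refine ENNReal.ofReal_le_ofReal ?_
        rw [ht]
        linarith
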